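/- Let $d\ge 1$, let $\Omega=[0,1)^d$ be the flat unit torus, and let $W\in C^3(\mathbb R)$ be a symmetric double-well potential: $W(s)=W(-s)$, $W\ge 0$, $W(s)=0$ if and only if $s=\pm1$, $W''(\pm1)>0$, $W''$ is nondecreasing on $[1,\infty)$ with $W''(s)\to+\infty$ as $s\to+\infty$, $|W'(s)|\le C(1+|s|^q)$ for some $C>0$ and $q>1$ (with $q<\frac{d+2}{d-2}$ if $d>2$), and $\int_{-1}^1\sqrt{2W(s)}\,ds=1$. Put $\kappa=W''(1)^{-1/2}$. Let $G_0, G\in L^1(\Omega)$ be the periodic Coulomb kernel and the periodic screened Coulomb kernel, i.e. the solutions (in the sense of distributions on the torus) of $$-\Delta G_0=\delta_0-1,\quad \int_\Omega G_0\,dx=0,\qquad\text{and}\qquad -\Delta G+\kappa^2G=\delta_0,$$ where $\delta_0$ is the Dirac mass at $0$. For $\varepsilon>0$ and $\bar u\in\mathbb R$ define, for $u\in H^1(\Omega)$ with $\int_\Omega u\,dx=\bar u$, the diffuse interface energy $$\mathcal E[u]=\int_\Omega\Big(\frac{\varepsilon^2}{2}|\nabla u|^2+W(u)\Big)dx+\frac12\int_\Omega\int_\Omega(u(x)-\bar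 u)\,G_0(x-y)\,(u(y)-\bar u)\,dx\,dy,$$ and, for $u_0\in BV(\Omega;\{-1,1\})$, the sharp interface energy $$E[u_0]=\frac{\varepsilon}{2}\int_\Omega|\nabla u_0|\,dx+\frac12\int_\Omega\int_\Omega(u_0(x)-\bar u)\,G(x-y)\,(u_0(y)-\bar u)\,dx\,dy,$$ where $\int_\Omega|\nabla u_0|\,dx$ is the total variation. Then there is $\bar\delta>0$, depending only on $d$ and $W$, such that for all $0<\delta\le\bar\delta$, all $\varepsilon>0$ and all $\bar u\in\mathbb R$ the following holds. If $u\in H^1(\Omega)$ satisfies $\int_\Omega u\,dx=\bar u$, $|u|\le 1+\delta^3$ and $\big|\int_\Omega G_0(x-y)(u(y)-\bar u)\,dy\big|\le\delta^3$ for almost every $x \in \Omega$, and $\mathcal E[u]\le\delta^{\frac32(d+6)}$, then there exists $u_0\in BV(\Omega;\{-1,1\})$ such that $$\mathcal E[u]\ge(1-\delta^{1/2})\,E[u_0].$$ -/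

import Mathlib

open MeasureTheory Set Filter Topology
open scoped ContDiff

noncomputable section

/-- The flat unit torus `Ω = [0,1)^d`; its `volume` is Lebesgue measure, of total mass `1`. -/
abbrev Torus (d : ℕ) : Type := UnitAddTorus (Fin d)

namespace Torus

variable {d : ℕ}

/-- A function on the torus is smooth if its periodic lift to `ℝ^d` is `C^∞`. -/
def IsSmooth (φ : Torus d → ℝ) : Prop :=
  ContDiff ℝ ∞ (fun y : Fin d → ℝ => φ (fun i => (y i : UnitAddCircle)))

/-- The `i`-th partial derivative of a function on the torus. -/
def pderiv (i : Fin d) (φ : Torus d → ℝ) (x : Torus d) : ℝ :=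
  deriv (fun s : ℝ => φ (x + Pi.single i (s : UnitAddCircle))) 0

/-- The (classical) Laplacian of a function on the torus. -/
def laplacian (φ : Torus d → ℝ) (x : Torus d) : ℝ :=
  ∑ i, pderiv i (pderiv i φ) x

/-- `g` is a weak gradient of `u`, with components in `L²`. -/
def IsWeakGradient (u : Torus d → ℝ) (g : Fin d → Torus d → ℝ) : Prop :=
  ∀ i, MemLp (g i) 2 ∧
    ∀ φ : Torus d → ℝ, IsSmooth φ → ∫ x, u x * pderiv i φ x = -∫ x, g i x * φ x

/-- The Sobolev space `H¹(Ω)`. -/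
def MemH1 (u : Torus d → ℝ) : Prop :=
  MemLp u 2 ∧ ∃ g, IsWeakGradient u g

open Classical in
/-- The weak gradient (unique up to null sets) of `u ∈ H¹(Ω)`; `0` for other functions. -/
def weakGradient (u : Torus d → ℝ) : Fin d → Torus d → ℝ :=
  if h : ∃ g, IsWeakGradient u g then h.choose else 0

/-- The total variation `∫_Ω |∇u| dx`, by duality with smooth vector fields `φ`, `|φ| ≤ 1`. -/
def totalVariation (u : Torus d → ℝ) : ENNReal :=
  ⨆ (φ : Fin d → Torus d → ℝ) (_ : (∀ i, IsSmooth (φ i)) ∧ ∀ x, ∑ i, φ i x ^ 2 ≤ 1),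
    ENNReal.ofReal (∫ x, u x * ∑ i, pderiv i (φ i) x)

/-- The class `BV(Ω; {-1, 1})`. -/
def IsBVSign (u : Torus d → ℝ) : Prop :=
  Integrable u ∧ totalVariation u ≠ ⊤ ∧ ∀ x, u x = 1 ∨ u x = -1

/-- `G₀` is the mean-zero periodic Coulomb kernel: `-ΔG₀ = δ - 1` in the sense of distributions
on the torus and `∫ G₀ = 0` (this determines `G₀` almost everywhere). -/
def IsCoulombKernel (G₀ : Torus d → ℝ) : Prop :=
  Integrable G₀ ∧ ∫ x, G₀ x = 0 ∧
    ∀ φ : Torus d → ℝ, IsSmooth φ → ∫ x, G₀ x * (-laplacian φ x) = φ 0 - ∫ x, φ x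

/-- `G` is the periodic screened Coulomb kernel: `-ΔG + κ² G = δ` in the sense of distributions
on the torus (this determines `G` almost everywhere). -/
def IsScreenedKernel (κ : ℝ) (G : Torus d → ℝ) : Prop :=
  Integrable G ∧
    ∀ φ : Torus d → ℝ, IsSmooth φ → ∫ x, G x * (-laplacian φ x + κ ^ 2 * φ x) = φ 0

/-- Symmetric double-well potentials with nondegenerate wells at `±1`, subject to the growth
conditions in dimension `d` and normalised to have unit surface tension. -/
structure IsDoubleWell (d : ℕ) (W : ℝ → ℝ) : Prop where
  contDiff : ContDiff ℝ 3 W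
  even : ∀ s, W (-s) = W s
  nonneg : ∀ s, 0 ≤ W s
  eq_zero_iff : ∀ s, W s = 0 ↔ s = 1 ∨ s = -1
  second_deriv_pos : 0 < deriv (deriv W) 1
  second_deriv_mono : MonotoneOn (deriv (deriv W)) (Ici 1)
  second_deriv_tendsto : Tendsto (deriv (deriv W)) atTop atTop
  growth : ∃ C q : ℝ, 0 < C ∧ 1 < q ∧ (2 < d → q < ((d : ℝ) + 2) / ((d : ℝ) - 2)) ∧
    ∀ s, |deriv W s| ≤ C * (1 + |s| ^ q)
  normalised : ∫ s in (-1 : ℝ)..1, √(2 * W s) = 1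

/-- The inverse screening length `κ = W''(1)^{-1/2}`. -/
def screening (W : ℝ → ℝ) : ℝ := 1 / √(deriv (deriv W) 1)

/-- The nonlocal potential `x ↦ ∫ K(x - y) (u(y) - ū) dy`. -/
def potential (K : Torus d → ℝ) (ubar : ℝ) (u : Torus d → ℝ) (x : Torus d) : ℝ :=
  ∫ y, K (x - y) * (u y - ubar)

/-- The nonlocal energy `½ ∬ (u(x) - ū) K(x - y) (u(y) - ū) dx dy`. -/
def nonlocalEnergy (K : Torus d → ℝ) (ubar : ℝ) (u : Torus d → ℝ) : ℝ :=
  1 / 2 * ∫ x, ∫ y, (u x - ubar) * K (x - y) * (u y - ubar)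

/-- The diffuse interface (Ohta-Kawasaki) energy, with Coulomb kernel `G₀`. -/
def diffuseEnergy (ε : ℝ) (W : ℝ → ℝ) (G₀ : Torus d → ℝ) (ubar : ℝ) (u : Torus d → ℝ) : ℝ :=
  (∫ x, (ε ^ 2 / 2 * ∑ i, weakGradient u i x ^ 2 + W (u x))) + nonlocalEnergy G₀ ubar u

/-- The sharp interface energy, with screened kernel `G`. -/
def sharpEnergy (ε : ℝ) (G : Torus d → ℝ) (ubar : ℝ) (u : Torus d → ℝ) : ℝ :=
  ε / 2 * (totalVariation u).toReal + nonlocalEnergy G ubar u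

end Torus

end

/-! Write f = u - ū, A = W''(1) = κ⁻². The sharp interface function is u₀ = ±1 according to whether
u > s, for a well chosen level s between -1+δ and 1-δ. Let T be the transition set where -1+δ < u ≤
1-δ.

On T the Modica–Mortola inequality bounds the local energy below by ε∫√(2W(u))|∇u|. A coarea-type
averaging argument (`IsWeakGradient.exists_totalVariation_phaseAbove_le`) gives a level s for which
this is at least (1 - O(δ)) times the perimeter term of u₀. Off T the value u is within δ of the
well u₀, so Taylor expansion gives W(u) ≥ (1 - O(δ)) (A/2)(u - u₀)².

Screening comes from this quadratic bulk cost. Put b = u₀ - ū and p = (u₀ - u)1_T, so that f + p - b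
= (u - u₀)1_{Tᶜ}. For a Fourier mode with symbol l > 0, minimising A|z - b̂|² + |z|²/l over z gives
|b̂|²/(l + κ²), the screened energy (`mode_bound_of_pos`, summed in `nonlocal_comparison`). The mode
0, where f̂ vanishes, is treated separately, at the price of a factor 1 - δ and a term in the L¹
norm of p.

The correction p lives on T, and |T| ≤ E/(cδ²) because W ≥ cδ² there. Its interaction with the
Coulomb potential of f is at most O(δ³|T|) by the smallness of that potential. Its self-energy is
split at frequency of order δ^(-3/2): low modes cost O(δ^(-3d/2)|T|²), high modes O(δ³|T|). The
assumed bound on E makes the quadratic terms O(δ³|T|) too. All remainders are thus O(δ³|T|) = O(δE),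
so the total relative loss is O(δ), below δ^(1/2) for small δ (`energy_bookkeeping`). -/

noncomputable section

namespace Torus

open UnitAddTorus ComplexConjugate

variable {d : ℕ}

/-! ### Fourier coefficients, Parseval and L² convergence. -/

/-- The product Haar measure on the torus. -/
abbrev haar : Measure (Torus d) := Measure.pi fun _ => AddCircle.haarAddCircle

/-- The period is 1, so no normalising factor appears; this transfers the Fourier theory for `haar`
to integrals against `volume`. -/
theorem volume_eq_pi_haar : (volume : Measure (Torus d)) = haar := by
  have h : (volume : Measure UnitAddCircle) = AddCircle.haarAddCircle := by
    simpa using AddCircle.volume_eq_smul_haarAddCircle (T := 1)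
  rw [volume_pi, h]

instance : IsProbabilityMeasure (volume : Measure (Torus d)) := by
  rw [volume_eq_pi_haar]; infer_instance

/-- The Fourier coefficients of a real-valued function on the torus. -/
def coeff (f : Torus d → ℝ) (k : Fin d → ℤ) : ℂ := ∫ x, mFourier (-k) x * (f x : ℂ)

theorem norm_mFourier_apply (k : Fin d → ℤ) (x : Torus d) : ‖mFourier k x‖ = 1 := by
  simp only [mFourier, fourier_apply, ContinuousMap.coe_mk, norm_prod, Circle.norm_coe,
    Finset.prod_const_one]

theorem mFourierCoeff_toLp_haar {f : Torus d → ℝ}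
    (hf : MemLp (fun x => (f x : ℂ)) 2 haar)
    (k : Fin d → ℤ) : mFourierCoeff (hf.toLp _) k = coeff f k := by
  rw [coeff, volume_eq_pi_haar]
  refine integral_congr_ae ?_
  filter_upwards [hf.coeFn_toLp] with x hx
  rw [hx, smul_eq_mul]

theorem memLp_ofReal_haar {f : Torus d → ℝ} (hf : MemLp f 2) :
    MemLp (fun x => (f x : ℂ)) 2 haar := by
  rw [← volume_eq_pi_haar]
  exact hf.ofReal

/-- Parseval's identity for real-valued functions on the torus. -/
theorem hasSum_coeff_mul {f g : Torus d → ℝ} (hf : MemLp f 2) (hg : MemLp g 2) :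
    HasSum (fun k => (conj (coeff f k) * coeff g k).re) (∫ x, f x * g x) := by
  have h := hasSum_prod_mFourierCoeff ((memLp_ofReal_haar hf).toLp _)
    ((memLp_ofReal_haar hg).toLp _)
  simp only [mFourierCoeff_toLp_haar] at h
  have h2 := Complex.hasSum_re h
  convert h2 using 1
  rw [volume_eq_pi_haar]
  have : (∫ x, f x * g x ∂haar) =
    (∫ x, ((f x * g x : ℝ) : ℂ) ∂haar).re := by
    rw [integral_complex_ofReal, Complex.ofReal_re]
  rw [this]
  congr 1
  refine integral_congr_ae ?_
  filter_upwards [(memLp_ofReal_haar hf).coeFn_toLp, (memLp_ofReal_haar hg).coeFn_toLp]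
    with x hx hy
  rw [hx, hy]
  simp

theorem hasSum_sq_coeff {f : Torus d → ℝ} (hf : MemLp f 2) :
    HasSum (fun k => ‖coeff f k‖ ^ 2) (∫ x, f x ^ 2) := by
  have h := hasSum_coeff_mul hf hf
  simp only [← pow_two] at h
  convert h using 2 with k
  rw [← Complex.normSq_eq_conj_mul_self, Complex.ofReal_re, Complex.normSq_eq_norm_sq]

/-- The real part of a trigonometric polynomial with coefficients `c`. -/
def trigPoly (c : (Fin d → ℤ) → ℂ) (F : Finset (Fin d → ℤ)) (x : Torus d) : ℝ :=
  (∑ k ∈ F, c k * mFourier k x).re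

theorem continuous_trigPoly (c : (Fin d → ℤ) → ℂ) (F : Finset (Fin d → ℤ)) :
    Continuous (trigPoly c F) := by
  unfold trigPoly
  fun_prop

theorem memLp_of_continuous {f : Torus d → ℝ} (hf : Continuous f) (p : ENNReal) : MemLp f p := by
  obtain ⟨C, hC⟩ := isCompact_univ.exists_bound_of_continuousOn hf.continuousOn
  exact MemLp.of_bound hf.aestronglyMeasurable C (ae_of_all _ fun x => hC x (mem_univ x))

/-- Fourier series converge in `L²`. -/
theorem tendsto_integral_sq_sub_trigPoly {f : Torus d → ℝ} (hf : MemLp f 2) :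
    Tendsto (fun F => ∫ x, (trigPoly (coeff f) F x - f x) ^ 2) atTop (𝓝 0) := by
  have h := hasSum_mFourier_series_L2 ((memLp_ofReal_haar hf).toLp _)
  simp only [mFourierCoeff_toLp_haar] at h
  unfold HasSum at h
  rw [SummationFilter.unconditional_filter, tendsto_iff_norm_sub_tendsto_zero] at h
  have h2 := h.pow 2
  simp only [ne_eq, OfNat.ofNat_ne_zero, not_false_eq_true, zero_pow] at h2
  refine squeeze_zero (fun F => integral_nonneg fun x => sq_nonneg _) (fun F => ?_) h2
  have hn : ∀ z : Lp ℂ 2 (haar (d := d)),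
      ‖z‖ ^ 2 = ∫ x, ‖z x‖ ^ 2 ∂(haar (d := d)) := by
    intro z
    have := L2.inner_def (𝕜 := ℂ) z z
    rw [inner_self_eq_norm_sq_to_K] at this
    simp only [inner_self_eq_norm_sq_to_K] at this
    have h3 := congrArg Complex.re this
    norm_cast at h3
  refine le_of_le_of_eq ?_ (hn _).symm
  rw [volume_eq_pi_haar]
  refine integral_mono_of_nonneg (ae_of_all _ fun x => sq_nonneg _) ?_ ?_
  · exact (memLp_two_iff_integrable_sq_norm (Lp.aestronglyMeasurable _)).1 (Lp.memLp _)
  · have hF : ∀ F : Finset (Fin d → ℤ),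
        ((∑ b ∈ F, coeff f b • mFourierLp 2 b : Lp ℂ 2 (haar (d := d))) : Torus d → ℂ)
        =ᵐ[haar]
        fun x => ∑ k ∈ F, coeff f k * mFourier k x := by
      intro F
      classical
      induction F using Finset.induction_on with
      | empty => simpa only [Finset.sum_empty] using! Lp.coeFn_zero ℂ 2 haar
      | insert k F hk ih =>
        rw [Finset.sum_insert hk]
        filter_upwards [Lp.coeFn_add (coeff f k • mFourierLp 2 k :
          Lp ℂ 2 (haar (d := d)))
          (∑ b ∈ F, coeff f b • mFourierLp 2 b), ih, coeFn_mFourierLp 2 k,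
          Lp.coeFn_smul (coeff f k) (mFourierLp 2 k :
            Lp ℂ 2 (haar (d := d)))] with x h1 h2 h3 h4
        rw [h1, Pi.add_apply, h2, h4, Pi.smul_apply, h3, Finset.sum_insert hk, smul_eq_mul]
    filter_upwards [hF F, Lp.coeFn_sub (∑ b ∈ F, coeff f b • mFourierLp 2 b)
      ((memLp_ofReal_haar hf).toLp _), (memLp_ofReal_haar hf).coeFn_toLp] with x h1 h2 h3
    have h4 : trigPoly (coeff f) F x - f x
        = ((∑ k ∈ F, coeff f k * mFourier k x) - (f x : ℂ)).re := by
      simp [trigPoly]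
    erw [h2]
    rw [Pi.sub_apply, h1, h3, h4]
    rw [← sq_abs]
    gcongr
    exact Complex.abs_re_le_norm _

/-! ### Partial derivatives on the torus and integration by parts. -/

/-- The covering map `ℝ^d → Torus d`. -/
def proj (y : Fin d → ℝ) : Torus d := fun i => (y i : UnitAddCircle)

theorem isOpenQuotientMap_proj : IsOpenQuotientMap (proj (d := d)) :=
  IsOpenQuotientMap.piMap (fun _ => QuotientAddGroup.isOpenQuotientMap_mk)

theorem proj_add_single (y : Fin d → ℝ) (i : Fin d) (s : ℝ) :
    proj (y + s • Pi.single i 1) = proj y + Pi.single i (s : UnitAddCircle) := by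
  funext j
  by_cases h : j = i
  · subst h; simp [proj]
  · simp [proj, h]

theorem IsSmooth.contDiff_comp_proj {φ : Torus d → ℝ} (h : IsSmooth φ) :
    ContDiff ℝ ∞ (φ ∘ proj) := h

theorem IsSmooth.continuous {φ : Torus d → ℝ} (h : IsSmooth φ) : Continuous φ :=
  isOpenQuotientMap_proj.isQuotientMap.continuous_iff.2 h.contDiff_comp_proj.continuous

/-- `ψ'` is the `i`-th partial derivative of `ψ` everywhere. -/
def HasPDeriv (i : Fin d) (ψ ψ' : Torus d → ℝ) : Prop :=
  ∀ x, HasDerivAt (fun s : ℝ => ψ (x + Pi.single i (s : UnitAddCircle))) (ψ' x) 0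

theorem HasPDeriv.pderiv_eq {i : Fin d} {ψ ψ' : Torus d → ℝ} (h : HasPDeriv i ψ ψ') :
    pderiv i ψ = ψ' := funext fun x => (h x).deriv

theorem HasPDeriv.hasDerivAt {i : Fin d} {ψ ψ' : Torus d → ℝ} (h : HasPDeriv i ψ ψ')
    (x : Torus d) (t : ℝ) :
    HasDerivAt (fun s : ℝ => ψ (x + Pi.single i (s : UnitAddCircle)))
      (ψ' (x + Pi.single i (t : UnitAddCircle))) t := by
  have h1 := h (x + Pi.single i (t : UnitAddCircle))
  rw [show (0 : ℝ) = t - t by simp] at h1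
  have h2 := h1.comp_sub_const t t
  refine h2.congr_of_eventuallyEq (.of_forall fun s => ?_)
  simp only [add_assoc, ← Pi.single_add, ← AddCircle.coe_add, add_sub_cancel]

theorem HasPDeriv.mul {i : Fin d} {ψ ψ' φ φ' : Torus d → ℝ} (h : HasPDeriv i ψ ψ')
    (h2 : HasPDeriv i φ φ') : HasPDeriv i (fun x => ψ x * φ x) (fun x => ψ' x * φ x + ψ x * φ' x) := by
  intro x
  refine ((h x).mul (h2 x)).congr_deriv ?_
  rw [AddCircle.coe_zero, Pi.single_zero, add_zero]

theorem HasPDeriv.comp {i : Fin d} {ψ ψ' : Torus d → ℝ} (h : HasPDeriv i ψ ψ')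
    {Φ Φ' : ℝ → ℝ} (h2 : ∀ t, HasDerivAt Φ (Φ' t) t) :
    HasPDeriv i (fun x => Φ (ψ x)) (fun x => Φ' (ψ x) * ψ' x) := by
  intro x
  have := (h2 (ψ (x + Pi.single i ((0 : ℝ) : UnitAddCircle)))).comp (0 : ℝ) (h x)
  simpa [Function.comp_def] using this

/-- By translation invariance `s ↦ ∫ ψ(x + s eᵢ)` is constant, and its derivative at 0, taken under
the integral sign, is `∫ ψ'`. -/
theorem HasPDeriv.integral_eq_zero {i : Fin d} {ψ ψ' : Torus d → ℝ} (h : HasPDeriv i ψ ψ')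
    (hc : Continuous ψ) (hc' : Continuous ψ') : ∫ x, ψ' x = 0 := by
  obtain ⟨C, hC⟩ := isCompact_univ.exists_bound_of_continuousOn hc'.continuousOn
  have hm : ∀ f : Torus d → ℝ, Continuous f → ∀ s : ℝ,
      Continuous fun x : Torus d => f (x + Pi.single i (s : UnitAddCircle)) := fun f hf s =>
    hf.comp (by fun_prop)
  have key : HasDerivAt (fun s : ℝ => ∫ x : Torus d, ψ (x + Pi.single i (s : UnitAddCircle)))
      (∫ x : Torus d, ψ' (x + Pi.single i ((0 : ℝ) : UnitAddCircle))) 0 := by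
    refine (hasDerivAt_integral_of_dominated_loc_of_deriv_le
      (F' := fun (s : ℝ) (x : Torus d) => ψ' (x + Pi.single i (s : UnitAddCircle)))
      (bound := fun _ => C) (s := univ) univ_mem
      (.of_forall fun s => (hm ψ hc s).aestronglyMeasurable)
      ((memLp_of_continuous (hm ψ hc 0) 1).integrable le_rfl)
      (hm ψ' hc' 0).aestronglyMeasurable ?_ (integrable_const _) ?_).2
    · exact ae_of_all _ fun x s _ => hC _ (mem_univ _)
    · exact ae_of_all _ fun x s _ => h.hasDerivAt x s
  have h2 : (fun s : ℝ => ∫ x : Torus d, ψ (x + Pi.single i (s : UnitAddCircle)))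
      = fun _ => ∫ x : Torus d, ψ x := funext fun s => integral_add_right_eq_self ψ _
  rw [h2, integral_add_right_eq_self ψ'] at key
  exact key.unique (hasDerivAt_const _ _)

theorem IsSmooth.hasPDeriv_proj {φ : Torus d → ℝ} (h : IsSmooth φ) (i : Fin d) (y : Fin d → ℝ) :
    HasDerivAt (fun s : ℝ => φ (proj y + Pi.single i (s : UnitAddCircle)))
      (fderiv ℝ (φ ∘ proj) y (Pi.single i 1)) 0 := by
  have h1 : HasFDerivAt (φ ∘ proj) (fderiv ℝ (φ ∘ proj) y) (y + (0 : ℝ) • Pi.single i 1) := by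
    simpa using (h.contDiff_comp_proj.differentiable (by simp) y).hasFDerivAt
  have h2 : HasDerivAt (fun s : ℝ => y + s • (Pi.single i 1 : Fin d → ℝ))
      (Pi.single i 1 : Fin d → ℝ) 0 := by
    simpa using ((hasDerivAt_id (0 : ℝ)).smul_const (Pi.single i 1 : Fin d → ℝ)).const_add y
  have h3 := h1.comp_hasDerivAt (0 : ℝ) h2
  simpa only [Function.comp_def, proj_add_single] using h3

theorem IsSmooth.pderiv_proj {φ : Torus d → ℝ} (h : IsSmooth φ) (i : Fin d) (y : Fin d → ℝ) :
    pderiv i φ (proj y) = fderiv ℝ (φ ∘ proj) y (Pi.single i 1) := (h.hasPDeriv_proj i y).deriv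

theorem IsSmooth.hasPDeriv {φ : Torus d → ℝ} (h : IsSmooth φ) (i : Fin d) :
    HasPDeriv i φ (pderiv i φ) := by
  intro x
  obtain ⟨y, rfl⟩ := isOpenQuotientMap_proj.surjective x
  rw [h.pderiv_proj]
  exact h.hasPDeriv_proj i y

theorem IsSmooth.pderiv {φ : Torus d → ℝ} (h : IsSmooth φ) (i : Fin d) :
    IsSmooth (pderiv i φ) := by
  have : (Torus.pderiv i φ ∘ proj) = fun y => fderiv ℝ (φ ∘ proj) y (Pi.single i 1) :=
    funext (h.pderiv_proj i)
  change ContDiff ℝ ∞ (Torus.pderiv i φ ∘ proj)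
  rw [this]
  exact (h.contDiff_comp_proj.fderiv_right (m := ∞) le_rfl).clm_apply contDiff_const

/-! ### Characters as test functions: Fourier symbols of weak gradients and kernels. -/

theorem mFourier_add_single (k : Fin d → ℤ) (x : Torus d) (i : Fin d) (s : UnitAddCircle) :
    mFourier k (x + Pi.single i s) = mFourier k x * fourier (k i) s := by
  simp only [mFourier, ContinuousMap.coe_mk]
  have : ∀ j, fourier (k j) ((x + Pi.single i s : Torus d) j)
      = fourier (k j) (x j) * (if j = i then fourier (k i) s else 1) := by
    intro j
    by_cases h : j = i
    · subst h; simp [fourier_apply, smul_add, AddCircle.toCircle_add]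
    · simp [h]
  rw [Finset.prod_congr rfl fun j _ => this j, Finset.prod_mul_distrib]
  simp

theorem hasDerivAt_mFourier (k : Fin d → ℤ) (x : Torus d) (i : Fin d) :
    HasDerivAt (fun s : ℝ => mFourier k (x + Pi.single i (s : UnitAddCircle)))
      (2 * Real.pi * Complex.I * k i * mFourier k x) 0 := by
  simp only [mFourier_add_single]
  have := (hasDerivAt_fourier 1 (k i) 0).const_mul (mFourier k x)
  rw [AddCircle.coe_zero, fourier_eval_zero] at this
  refine this.congr_deriv ?_
  push_cast
  ring

theorem hasPDeriv_re_mFourier (c : ℂ) (k : Fin d → ℤ) (i : Fin d) :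
    HasPDeriv i (fun x => (c * mFourier k x).re)
      (fun x => (2 * Real.pi * Complex.I * k i * c * mFourier k x).re) := by
  intro x
  have := Complex.reCLM.hasFDerivAt.comp_hasDerivAt (0 : ℝ) ((hasDerivAt_mFourier k x i).const_mul c)
  refine this.congr_deriv ?_
  rw [Complex.reCLM_apply]
  congr 1
  ring

theorem isSmooth_re_mFourier (c : ℂ) (k : Fin d → ℤ) :
    IsSmooth (fun x => (c * mFourier k x).re) := by
  unfold IsSmooth
  simp only [mFourier, ContinuousMap.coe_mk, fourier_coe_apply]
  refine Complex.reCLM.contDiff.comp (contDiff_const.mul (contDiff_prod fun j _ => ?_))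
  refine Complex.contDiff_exp.comp ?_
  refine ContDiff.div_const (contDiff_const.mul ?_) _
  exact Complex.ofRealCLM.contDiff.comp (contDiff_apply ℝ ℝ j)

theorem pderiv_re_mFourier (c : ℂ) (k : Fin d → ℤ) (i : Fin d) :
    pderiv i (fun x => (c * mFourier k x).re)
      = (fun x => (2 * Real.pi * Complex.I * k i * c * mFourier k x).re) :=
  (hasPDeriv_re_mFourier c k i).pderiv_eq

/-- The symbol `4π²|k|²` of the negative Laplacian on the torus. -/
def freq (k : Fin d → ℤ) : ℝ := 4 * Real.pi ^ 2 * ∑ i, (k i : ℝ) ^ 2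

theorem laplacian_re_mFourier (c : ℂ) (k : Fin d → ℤ) (x : Torus d) :
    laplacian (fun x => (c * mFourier k x).re) x = -freq k * (c * mFourier k x).re := by
  unfold laplacian freq
  simp only [pderiv_re_mFourier]
  rw [Finset.mul_sum, ← Finset.sum_neg_distrib, Finset.sum_mul]
  refine Finset.sum_congr rfl fun i _ => ?_
  have : 2 * Real.pi * Complex.I * k i * (2 * Real.pi * Complex.I * k i * c) * mFourier k x
      = ((-(4 * Real.pi ^ 2 * (k i : ℝ) ^ 2) : ℝ) : ℂ) * (c * mFourier k x) := by
    push_cast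
    linear_combination (4 * Real.pi ^ 2 * (k i : ℂ) ^ 2 * c * mFourier k x) * Complex.I_sq
  rw [this, Complex.re_ofReal_mul]

theorem integrable_mFourier_mul {f : Torus d → ℝ} (hf : Integrable f) (k : Fin d → ℤ) :
    Integrable (fun x => mFourier k x * (f x : ℂ)) :=
  hf.ofReal.bdd_mul (mFourier k).continuous.aestronglyMeasurable
    (ae_of_all _ fun x => (norm_mFourier_apply k x).le)

theorem re_mul_coeff {f : Torus d → ℝ} (hf : Integrable f) (c : ℂ) (k : Fin d → ℤ) :
    (c * coeff f k).re = ∫ x, f x * (c * mFourier (-k) x).re := by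
  unfold coeff
  rw [← integral_const_mul, ← RCLike.re_eq_complex_re,
    ← integral_re ((integrable_mFourier_mul hf _).const_mul c)]
  refine integral_congr_ae (ae_of_all _ fun x => ?_)
  simp only [RCLike.re_eq_complex_re]
  rw [← mul_assoc, mul_comm, Complex.re_ofReal_mul]

/-- Test functions are real, so a complex coefficient is recovered from pairings with Re(c e₋ₖ) for
all complex c; c = 1 and c = i suffice. -/
theorem eq_of_forall_re_mul_eq {z w : ℂ} (h : ∀ c : ℂ, (c * z).re = (c * w).re) : z = w := by
  apply Complex.ext
  · simpa using h 1
  · simpa using h Complex.I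

theorem IsWeakGradient.coeff_eq {u : Torus d → ℝ} {g : Fin d → Torus d → ℝ}
    (hu : Integrable u) (h : IsWeakGradient u g) (i : Fin d) (k : Fin d → ℤ) :
    coeff (g i) k = 2 * Real.pi * Complex.I * k i * coeff u k := by
  refine eq_of_forall_re_mul_eq fun c => ?_
  have h1 := (h i).2 _ (isSmooth_re_mFourier c (-k))
  rw [pderiv_re_mFourier, ← re_mul_coeff hu, ← re_mul_coeff ((h i).1.integrable one_le_two)] at h1
  rw [← neg_eq_iff_eq_neg.2 h1, ← Complex.neg_re]
  congr 1
  simp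
  ring

theorem freq_neg (k : Fin d → ℤ) : freq (-k) = freq k := by simp [freq]

theorem integral_re_mFourier (c : ℂ) {k : Fin d → ℤ} (hk : k ≠ 0) :
    ∫ x, (c * mFourier k x).re = 0 := by
  obtain ⟨i, hi⟩ := Function.ne_iff.1 hk
  have hi' : (k i : ℂ) ≠ 0 := by exact_mod_cast hi
  have h := hasPDeriv_re_mFourier (c / (2 * Real.pi * Complex.I * k i)) k i
  have h2 := h.integral_eq_zero (by fun_prop) (by fun_prop)
  have hpi : (Real.pi : ℂ) ≠ 0 := by exact_mod_cast Real.pi_ne_zero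
  rwa [mul_div_cancel₀] at h2
  simp [hi', hpi, Complex.I_ne_zero]

theorem coeff_zero (f : Torus d → ℝ) : coeff f 0 = ((∫ x, f x : ℝ) : ℂ) := by
  simp [coeff, mFourier_zero]
  exact integral_complex_ofReal

theorem freq_eq_zero_iff {k : Fin d → ℤ} : freq k = 0 ↔ k = 0 := by
  unfold freq
  rw [mul_eq_zero, Finset.sum_eq_zero_iff_of_nonneg (fun _ _ => sq_nonneg _)]
  simp [funext_iff]

theorem freq_nonneg (k : Fin d → ℤ) : 0 ≤ freq k := by unfold freq; positivity

theorem mFourier_apply_zero (k : Fin d → ℤ) : mFourier k 0 = 1 := by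
  simp [mFourier]

/-- At k = 0 the formula relies on the convention `0⁻¹ = 0`, which agrees with the zero mean of G₀.
-/
theorem IsCoulombKernel.coeff_eq {G₀ : Torus d → ℝ} (h : IsCoulombKernel G₀) (k : Fin d → ℤ) :
    coeff G₀ k = ((freq k)⁻¹ : ℝ) := by
  by_cases hk : k = 0
  · subst hk
    rw [coeff_zero, h.2.1, freq_eq_zero_iff.2 rfl, inv_zero]
  have hf : freq k ≠ 0 := fun hf => hk (freq_eq_zero_iff.1 hf)
  suffices H : (freq k : ℂ) * coeff G₀ k = 1 by
    have : (freq k : ℂ) ≠ 0 := by exact_mod_cast hf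
    rw [Complex.ofReal_inv]
    exact eq_inv_of_mul_eq_one_right H
  refine eq_of_forall_re_mul_eq fun c => ?_
  have h1 := h.2.2 _ (isSmooth_re_mFourier c (-k))
  simp only [laplacian_re_mFourier, integral_re_mFourier c (neg_ne_zero.2 hk), freq_neg,
    mFourier_apply_zero, sub_zero] at h1
  rw [← h1, ← mul_assoc, mul_comm c, mul_assoc, Complex.re_ofReal_mul, re_mul_coeff h.1,
    ← integral_const_mul]
  congr with x
  ring

theorem IsScreenedKernel.coeff_eq {κ : ℝ} (hκ : κ ≠ 0) {G : Torus d → ℝ}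
    (h : IsScreenedKernel κ G) (k : Fin d → ℤ) :
    coeff G k = ((freq k + κ ^ 2)⁻¹ : ℝ) := by
  have hf : freq k + κ ^ 2 ≠ 0 := by have := freq_nonneg k; positivity
  suffices H : ((freq k + κ ^ 2 : ℝ) : ℂ) * coeff G k = 1 by
    rw [Complex.ofReal_inv]
    exact eq_inv_of_mul_eq_one_right H
  refine eq_of_forall_re_mul_eq fun c => ?_
  have h1 := h.2 _ (isSmooth_re_mFourier c (-k))
  simp only [laplacian_re_mFourier, freq_neg, mFourier_apply_zero] at h1
  rw [← h1, ← mul_assoc, mul_comm c, mul_assoc, Complex.re_ofReal_mul, re_mul_coeff h.1,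
    ← integral_const_mul]
  congr with x
  ring

/-! ### Convolution as a Fourier multiplier. -/

instance : (volume : Measure (Torus d)).IsNegInvariant :=
  Measure.IsAddHaarMeasure.isNegInvariant_of_regular _

/-- Convolution on the torus. -/
def conv (K f : Torus d → ℝ) (x : Torus d) : ℝ := ∫ y, K (x - y) * f y

theorem integrable_conv_integrand {K f : Torus d → ℝ} (hK : Integrable K) (hf : Integrable f) :
    Integrable (fun p : Torus d × Torus d => K (p.1 - p.2) * f p.2) := by
  have := hf.convolution_integrand (ContinuousLinearMap.mul ℝ ℝ) hK (μ := volume) (ν := volume)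
  refine this.congr (ae_of_all _ fun p => ?_)
  simp [mul_comm]

theorem integrable_conv {K f : Torus d → ℝ} (hK : Integrable K) (hf : Integrable f) :
    Integrable (conv K f) := (integrable_conv_integrand hK hf).integral_prod_left

theorem coeff_conv {K f : Torus d → ℝ} (hK : Integrable K) (hf : Integrable f)
    (k : Fin d → ℤ) : coeff (conv K f) k = coeff K k * coeff f k := by
  have h1 := integrable_conv_integrand hK hf
  have h2 : Integrable (fun p : Torus d × Torus d =>
      mFourier (-k) p.1 * ((K (p.1 - p.2) * f p.2 : ℝ) : ℂ)) :=
    h1.ofReal.bdd_mul (c := 1) ((mFourier (-k)).continuous.comp continuous_fst).aestronglyMeasurable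
      (ae_of_all _ fun x => (norm_mFourier_apply _ _).le)
  calc coeff (conv K f) k
      = ∫ x, ∫ y, mFourier (-k) x * ((K (x - y) * f y : ℝ) : ℂ) := by
        unfold coeff conv
        congr with x
        rw [integral_const_mul, integral_complex_ofReal]
    _ = ∫ y, ∫ x, mFourier (-k) x * ((K (x - y) * f y : ℝ) : ℂ) := integral_integral_swap h2
    _ = ∫ y, coeff K k * (mFourier (-k) y * (f y : ℂ)) := by
        congr with y
        rw [← integral_add_right_eq_self _ y]
        simp only [add_sub_cancel_right]
        unfold coeff
        rw [← integral_mul_const]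
        congr with x
        have : mFourier (-k) (x + y) = mFourier (-k) x * mFourier (-k) y := by
          simp [mFourier, fourier_apply, smul_add, AddCircle.toCircle_add, Finset.prod_mul_distrib]
        rw [this]
        push_cast
        ring
    _ = coeff K k * coeff f k := by rw [integral_const_mul]; rfl

theorem abs_conv_le {K f : Torus d → ℝ} (hK : Integrable K) {M : ℝ}
    (hM : ∀ᵐ x, |f x| ≤ M) (x : Torus d) : |conv K f x| ≤ M * ∫ y, |K y| := by
  rw [← integral_sub_left_eq_self _ volume x, ← integral_const_mul]
  refine (abs_integral_le_integral_abs).trans (integral_mono_of_nonneg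
    (ae_of_all _ fun _ => abs_nonneg _) ((hK.abs.comp_sub_left x).const_mul M) ?_)
  filter_upwards [hM] with y hy
  rw [abs_mul, mul_comm]
  gcongr

theorem memLp_conv {K f : Torus d → ℝ} (hK : Integrable K) (hf : Integrable f) {M : ℝ}
    (hM : ∀ᵐ x, |f x| ≤ M) (p : ENNReal) : MemLp (conv K f) p :=
  MemLp.of_bound (integrable_conv hK hf).1 _ (ae_of_all _ fun x => abs_conv_le hK hM x)

/-- Parseval combined with the convolution theorem. The kernel is only integrable, so it is the
boundedness of f that puts `conv K f` in L². -/
theorem hasSum_integral_mul_conv {K f h : Torus d → ℝ} (hK : Integrable K) {m : (Fin d → ℤ) → ℝ}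
    (hm : ∀ k, coeff K k = m k) (hf : MemLp f 2) {M : ℝ}
    (hM : ∀ᵐ x, |f x| ≤ M) (hh : MemLp h 2) :
    HasSum (fun k => m k * (conj (coeff h k) * coeff f k).re) (∫ x, h x * conv K f x) := by
  have hfi := hf.integrable one_le_two
  convert hasSum_coeff_mul hh (memLp_conv hK hfi hM 2) using 2 with k
  rw [coeff_conv hK hfi, hm, ← Complex.re_ofReal_mul]
  congr 1
  ring

/-! ### Chain rule for weak gradients by trigonometric approximation. -/

theorem integral_abs_mul_abs_le {a b : Torus d → ℝ} (ha : MemLp a 2) (hb : MemLp b 2) :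
    ∫ x, |a x| * |b x| ≤ √(∫ x, a x ^ 2) * √(∫ x, b x ^ 2) := by
  have h := integral_mul_le_Lp_mul_Lq_of_nonneg (μ := (volume : Measure (Torus d)))
    Real.HolderConjugate.two_two (f := fun x => |a x|) (g := fun x => |b x|)
    (ae_of_all _ fun _ => abs_nonneg _) (ae_of_all _ fun _ => abs_nonneg _)
    (by simpa using! ha.norm) (by simpa using! hb.norm)
  simpa [Real.sqrt_eq_rpow] using h

theorem hasPDeriv_trigPoly (c : (Fin d → ℤ) → ℂ) (F : Finset (Fin d → ℤ)) (i : Fin d) :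
    HasPDeriv i (trigPoly c F) (trigPoly (fun k => 2 * Real.pi * Complex.I * k i * c k) F) := by
  intro x
  unfold trigPoly
  simp only [Complex.re_sum]
  exact HasDerivAt.fun_sum fun k _ => hasPDeriv_re_mFourier (c k) k i x

/-- Differentiation commutes with Fourier truncation, so the partial sums of u converge in L²
together with their gradients and can play the role of mollifications. -/
theorem IsWeakGradient.hasPDeriv_trigPoly {u : Torus d → ℝ} {g : Fin d → Torus d → ℝ}
    (hu : MemLp u 2) (h : IsWeakGradient u g) (F : Finset (Fin d → ℤ)) (i : Fin d) :
    HasPDeriv i (trigPoly (coeff u) F) (trigPoly (coeff (g i)) F) := by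
  have : coeff (g i) = fun k => 2 * Real.pi * Complex.I * k i * coeff u k :=
    funext fun k => h.coeff_eq (hu.integrable one_le_two) i k
  rw [this]
  exact Torus.hasPDeriv_trigPoly _ F i

theorem memLp_mul_of_continuous {f φ : Torus d → ℝ} (hf : MemLp f 2) (hφ : Continuous φ) :
    MemLp (fun x => f x * φ x) 2 :=
  MemLp.mul' (memLp_of_continuous hφ ⊤) hf

theorem memLp_comp_of_lipschitz {u : Torus d → ℝ} (hu : MemLp u 2) {Φ : ℝ → ℝ} {L : ℝ}
    (hL0 : 0 ≤ L) (hΦc : Continuous Φ) (hΦL : ∀ s t, |Φ s - Φ t| ≤ L * |s - t|) :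
    MemLp (fun x => Φ (u x)) 2 := by
  have h0 : MemLp (fun x => L * |u x|) 2 := hu.norm.const_mul L
  have h1 : MemLp (fun x => |Φ 0| + L * |u x|) 2 :=
    (memLp_const (μ := (volume : Measure (Torus d))) |Φ 0|).add h0
  refine h1.mono (hΦc.comp_aestronglyMeasurable hu.1) (ae_of_all _ fun x => ?_)
  rw [Real.norm_eq_abs, Real.norm_eq_abs, abs_of_nonneg (a := _ + _) (by positivity)]
  have h2 := hΦL (u x) 0
  rw [sub_zero] at h2
  have h3 := abs_sub_abs_le_abs_sub (Φ (u x)) (Φ 0)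
  linarith

theorem integrable_of_continuous {f : Torus d → ℝ} (hf : Continuous f) : Integrable f :=
  (memLp_of_continuous hf 1).integrable le_rfl

theorem tendsto_integral_comp_mul {ι : Type*} {l : Filter ι} {S : ι → Torus d → ℝ}
    {u b : Torus d → ℝ} (hS : ∀ F, Continuous (S F)) (hu : MemLp u 2)
    (hSu : Tendsto (fun F => ∫ x, (S F x - u x) ^ 2) l (𝓝 0)) {Φ : ℝ → ℝ} {L : ℝ}
    (hL0 : 0 ≤ L) (hΦc : Continuous Φ) (hΦL : ∀ s t, |Φ s - Φ t| ≤ L * |s - t|)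
    (hb : Continuous b) :
    Tendsto (fun F => ∫ x, Φ (S F x) * b x) l (𝓝 (∫ x, Φ (u x) * b x)) := by
  have hb2 := memLp_of_continuous hb 2
  have hSm : ∀ F, MemLp (fun x => S F x - u x) 2 := fun F => (memLp_of_continuous (hS F) 2).sub hu
  have hS0 := hSu.sqrt
  rw [Real.sqrt_zero] at hS0
  rw [tendsto_iff_dist_tendsto_zero]
  have hlim : Tendsto (fun F => L * (√(∫ x, (S F x - u x) ^ 2) * √(∫ x, b x ^ 2)))
      l (𝓝 0) := by
    simpa using (hS0.mul_const (√(∫ x, b x ^ 2))).const_mul L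
  refine squeeze_zero (fun _ => dist_nonneg) (fun F => ?_) hlim
  have hΦu : Integrable fun x => Φ (u x) * b x :=
    (memLp_comp_of_lipschitz hu hL0 hΦc hΦL).integrable_mul hb2
  rw [Real.dist_eq, ← integral_sub (integrable_of_continuous (by have := hS F; fun_prop)) hΦu]
  refine abs_integral_le_integral_abs.trans ?_
  refine le_trans ?_ (mul_le_mul_of_nonneg_left (integral_abs_mul_abs_le (hSm F) hb2) hL0)
  rw [← integral_const_mul]
  refine integral_mono_of_nonneg (ae_of_all _ fun _ => abs_nonneg _)
    (((hSm F).norm.integrable_mul hb2.norm).const_mul L) (ae_of_all _ fun x => ?_)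
  simp only
  rw [← sub_mul, abs_mul, ← mul_assoc]
  gcongr
  exact hΦL _ _

/-- The difference splits into ψ(S)φ(D - g), small because ψφ is bounded, and (ψ(S) - ψ(u))gφ, small
by the Lipschitz bound and Cauchy–Schwarz. -/
theorem tendsto_integral_comp_mul_mul {ι : Type*} {l : Filter ι} {S D : ι → Torus d → ℝ}
    {u g φ : Torus d → ℝ} (hS : ∀ F, Continuous (S F)) (hD : ∀ F, Continuous (D F))
    (hu : MemLp u 2) (hg : MemLp g 2)
    (hSu : Tendsto (fun F => ∫ x, (S F x - u x) ^ 2) l (𝓝 0))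
    (hDg : Tendsto (fun F => ∫ x, (D F x - g x) ^ 2) l (𝓝 0)) {ψ : ℝ → ℝ} {L ℓ : ℝ}
    (hψc : Continuous ψ) (hL : ∀ t, |ψ t| ≤ L) (hℓ : ∀ s t, |ψ s - ψ t| ≤ ℓ * |s - t|)
    (hφ : Continuous φ) :
    Tendsto (fun F => ∫ x, ψ (S F x) * (D F x * φ x)) l (𝓝 (∫ x, ψ (u x) * (g x * φ x))) := by
  obtain ⟨C, hC⟩ := isCompact_univ.exists_bound_of_continuousOn hφ.continuousOn
  have hC' : ∀ x, |φ x| ≤ C := fun x => hC x (mem_univ x)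
  have hC0 : 0 ≤ C := (abs_nonneg _).trans (hC' 0)
  have hL0 : 0 ≤ L := (abs_nonneg _).trans (hL 0)
  have hℓ0 : 0 ≤ ℓ := by simpa using (abs_nonneg _).trans (hℓ 1 0)
  have hgφ := memLp_mul_of_continuous hg hφ
  have hSm : ∀ F, MemLp (fun x => S F x - u x) 2 := fun F => (memLp_of_continuous (hS F) 2).sub hu
  have hDm : ∀ F, MemLp (fun x => D F x - g x) 2 := fun F => (memLp_of_continuous (hD F) 2).sub hg
  have hS0 := hSu.sqrt
  have hD0 := hDg.sqrt
  rw [Real.sqrt_zero] at hS0 hD0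
  rw [tendsto_iff_dist_tendsto_zero]
  have hb : Tendsto (fun F => L * C * √(∫ x, (D F x - g x) ^ 2)
      + ℓ * (√(∫ x, (S F x - u x) ^ 2) * √(∫ x, (g x * φ x) ^ 2))) l (𝓝 0) := by
    simpa using (hD0.const_mul (L * C)).add
      ((hS0.mul_const (√(∫ x, (g x * φ x) ^ 2))).const_mul ℓ)
  refine squeeze_zero (fun _ => dist_nonneg) (fun F => ?_) hb
  have hψu : Integrable fun x => ψ (u x) * (g x * φ x) :=
    (hgφ.integrable one_le_two).bdd_mul (c := L) (hψc.comp_aestronglyMeasurable hu.1)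
      (ae_of_all _ fun x => hL _)
  rw [Real.dist_eq, ← integral_sub
    (integrable_of_continuous (by have := hS F; have := hD F; fun_prop)) hψu]
  refine abs_integral_le_integral_abs.trans ?_
  have e1 : ∫ x, |D F x - g x| ≤ √(∫ x, (D F x - g x) ^ 2) := by
    simpa using integral_abs_mul_abs_le (hDm F) (memLp_const (1 : ℝ))
  have e2 := integral_abs_mul_abs_le (hSm F) hgφ
  refine le_trans ?_ (add_le_add (mul_le_mul_of_nonneg_left e1 (mul_nonneg hL0 hC0))
    (mul_le_mul_of_nonneg_left e2 hℓ0))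
  have i1 : Integrable fun x => L * C * |D F x - g x| :=
    ((hDm F).norm.integrable one_le_two).const_mul (L * C)
  have i2 : Integrable fun x => ℓ * (|S F x - u x| * |g x * φ x|) :=
    ((hSm F).norm.integrable_mul hgφ.norm).const_mul ℓ
  rw [← integral_const_mul, ← integral_const_mul, ← integral_add i1 i2]
  refine integral_mono_of_nonneg (ae_of_all _ fun _ => abs_nonneg _) (i1.add i2)
    (ae_of_all _ fun x => ?_)
  simp only
  have : ψ (S F x) * (D F x * φ x) - ψ (u x) * (g x * φ x)
      = ψ (S F x) * φ x * (D F x - g x) + (ψ (S F x) - ψ (u x)) * (g x * φ x) := by ring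
  rw [this]
  refine (abs_add_le _ _).trans ?_
  rw [abs_mul, abs_mul, abs_mul (_ - _), ← mul_assoc ℓ]
  gcongr
  · exact hL _
  · exact hC' _
  · exact hℓ _ _

theorem continuous_of_abs_sub_le {ψ : ℝ → ℝ} {ℓ : ℝ} (hℓ : ∀ s t, |ψ s - ψ t| ≤ ℓ * |s - t|) :
    Continuous ψ := by
  have : LipschitzWith (Real.toNNReal ℓ) ψ :=
    LipschitzWith.of_dist_le' (by simpa [Real.dist_eq] using hℓ)
  exact this.continuous

/-- Chain rule for weak gradients. -/
theorem IsWeakGradient.integral_comp_mul_pderiv {u : Torus d → ℝ} {g : Fin d → Torus d → ℝ}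
    (hu : MemLp u 2) (hg : IsWeakGradient u g) {Φ ψ : ℝ → ℝ} (hΦ : ∀ t, HasDerivAt Φ (ψ t) t)
    {L ℓ : ℝ} (hL : ∀ t, |ψ t| ≤ L) (hℓ : ∀ s t, |ψ s - ψ t| ≤ ℓ * |s - t|)
    {φ : Torus d → ℝ} (hφ : IsSmooth φ) (i : Fin d) :
    ∫ x, Φ (u x) * pderiv i φ x = -∫ x, ψ (u x) * (g i x * φ x) := by
  have hψc : Continuous ψ := continuous_of_abs_sub_le hℓ
  have hΦL : ∀ s t, |Φ s - Φ t| ≤ L * |s - t| := by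
    intro s t
    have := Convex.norm_image_sub_le_of_norm_hasDerivWithin_le (f := Φ) (f' := ψ) (C := L)
      (s := univ) (fun t _ => (hΦ t).hasDerivWithinAt) (fun t _ => by simpa using hL t)
      convex_univ (mem_univ t) (mem_univ s)
    simpa using this
  have hΦc := continuous_of_abs_sub_le hΦL
  have hφc := hφ.continuous
  have hφ'c := (hφ.pderiv i).continuous
  have hSc : ∀ F, Continuous (trigPoly (coeff u) F) := continuous_trigPoly _
  have hDc : ∀ F, Continuous (trigPoly (coeff (g i)) F) := continuous_trigPoly _
  have lim1 := tendsto_integral_comp_mul hSc hu (tendsto_integral_sq_sub_trigPoly hu)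
    ((abs_nonneg _).trans (hL 0)) hΦc hΦL hφ'c
  have lim2 := tendsto_integral_comp_mul_mul hSc hDc hu (hg i).1
    (tendsto_integral_sq_sub_trigPoly hu) (tendsto_integral_sq_sub_trigPoly (hg i).1)
    hψc hL hℓ hφc
  -- For smooth partial sums this is the classical chain rule plus integration by parts; both sides
  -- then pass to the limit.
  have hbyparts : ∀ F, ∫ x, Φ (trigPoly (coeff u) F x) * pderiv i φ x
      = -∫ x, ψ (trigPoly (coeff u) F x) * (trigPoly (coeff (g i)) F x * φ x) := by
    intro F
    have c1 := hSc F
    have c2 := hDc F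
    have h1 := ((hg.hasPDeriv_trigPoly hu F i).comp hΦ).mul (hφ.hasPDeriv i)
    have h2 := h1.integral_eq_zero (by fun_prop) (by fun_prop)
    rw [integral_add (integrable_of_continuous (by fun_prop))
      (integrable_of_continuous (by fun_prop))] at h2
    simp only [mul_assoc] at h2
    linarith
  simp only [hbyparts] at lim1
  exact tendsto_nhds_unique lim1 lim2.neg

/-- The Euclidean norm of a vector field. -/
def gradNorm (g : Fin d → Torus d → ℝ) (x : Torus d) : ℝ := √(∑ i, g i x ^ 2)

theorem memLp_gradNorm {g : Fin d → Torus d → ℝ} (hg : ∀ i, MemLp (g i) 2) :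
    MemLp (gradNorm g) 2 := by
  have h1 : MemLp (fun x => ∑ i, |g i x|) 2 := memLp_finsetSum _ fun i _ => (hg i).norm
  refine h1.mono ?_ (ae_of_all _ fun x => ?_)
  · refine Real.continuous_sqrt.comp_aestronglyMeasurable ?_
    exact Finset.aestronglyMeasurable_fun_sum _ fun i _ => (hg i).1.pow 2
  · rw [gradNorm, Real.norm_eq_abs, abs_of_nonneg (Real.sqrt_nonneg _), Real.norm_eq_abs,
      abs_of_nonneg (Finset.sum_nonneg fun _ _ => abs_nonneg _)]
    refine Real.sqrt_le_iff.2 ⟨Finset.sum_nonneg fun _ _ => abs_nonneg _, ?_⟩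
    simp only [← sq_abs (g _ x)]
    exact Finset.sum_sq_le_sq_sum_of_nonneg fun i _ => abs_nonneg _

/-- The chain rule in each coordinate, followed by the pointwise Cauchy–Schwarz inequality |∇u · φ|
≤ |∇u|. -/
theorem IsWeakGradient.integral_comp_mul_div_le {u : Torus d → ℝ} {g : Fin d → Torus d → ℝ}
    (hu : MemLp u 2) (hg : IsWeakGradient u g) {Φ ψ : ℝ → ℝ} (hΦ : ∀ t, HasDerivAt Φ (ψ t) t)
    {L ℓ : ℝ} (hL : ∀ t, |ψ t| ≤ L) (hℓ : ∀ s t, |ψ s - ψ t| ≤ ℓ * |s - t|)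
    (hΦ1 : ∀ t, |Φ t| ≤ 1) {φ : Fin d → Torus d → ℝ}
    (hφ : (∀ i, IsSmooth (φ i)) ∧ ∀ x, ∑ i, φ i x ^ 2 ≤ 1) :
    ∫ x, Φ (u x) * ∑ i, pderiv i (φ i) x ≤ ∫ x, |ψ (u x)| * gradNorm g x := by
  have hψc : Continuous ψ := continuous_of_abs_sub_le hℓ
  have hΦc : Continuous Φ := continuous_iff_continuousAt.2 fun t => (hΦ t).continuousAt
  have hgφ : ∀ i, Integrable (fun x => g i x * φ i x) := fun i =>
    (hg i).1.integrable_mul (memLp_of_continuous (hφ.1 i).continuous 2)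
  have hψu : ∀ i, Integrable fun x => ψ (u x) * (g i x * φ i x) := fun i =>
    (hgφ i).bdd_mul (c := L) (hψc.comp_aestronglyMeasurable hu.1) (ae_of_all _ fun x => hL _)
  simp only [Finset.mul_sum]
  rw [integral_finsetSum]
  swap
  · intro i _
    exact ((memLp_of_continuous ((hφ.1 i).pderiv i).continuous 1).integrable le_rfl).bdd_mul (c := 1)
      (hΦc.comp_aestronglyMeasurable hu.1) (ae_of_all _ fun x => hΦ1 _)
  rw [Finset.sum_congr rfl fun i _ => hg.integral_comp_mul_pderiv hu hΦ hL hℓ (hφ.1 i) i,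
    Finset.sum_neg_distrib, ← integral_finsetSum _ fun i _ => hψu i, ← integral_neg]
  refine integral_mono (integrable_finsetSum _ fun i _ => hψu i).neg ?_ fun x => ?_
  · exact ((memLp_gradNorm fun i => (hg i).1).integrable one_le_two).bdd_mul (c := L)
      (hψc.abs.comp_aestronglyMeasurable hu.1) (ae_of_all _ fun x => by simpa using hL _)
  · simp only [← Finset.mul_sum]
    refine (neg_le_abs _).trans ?_
    rw [abs_mul]
    gcongr
    rw [gradNorm]
    refine Real.abs_le_sqrt ?_
    refine (Finset.sum_mul_sq_le_sq_mul_sq _ _ _).trans ?_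
    exact mul_le_of_le_one_right (Finset.sum_nonneg fun _ _ => sq_nonneg _) (hφ.2 x)

/-! ### Coarea-type selection of a level set of small perimeter. -/

/-- A smoothed sign function at level s: the chain rule above needs a Lipschitz derivative, and
sharpness of the perimeter bound needs a slope asymptotic to 2/h as h → 0. -/
theorem exists_ramp (s : ℝ) {h : ℝ} (h0 : 0 < h) (h1 : h < 1 / 2) :
    ∃ Φ ψ : ℝ → ℝ, (∀ t, HasDerivAt Φ (ψ t) t) ∧
      (∃ ℓ, ∀ x y, |ψ x - ψ y| ≤ ℓ * |x - y|) ∧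
      (∀ t, 0 ≤ ψ t ∧ ψ t ≤ 2 / (h - 2 * h ^ 2)) ∧ (∀ t, t ∉ Ioc s (s + h) → ψ t = 0) ∧
      (∀ t, |Φ t| ≤ 1) ∧ (∀ t, t ≤ s → Φ t = -1) ∧ ∀ t, s + h ≤ t → Φ t = 1 := by
  -- A trapezoid of height 1 on [s, s+h] with flanks of width h², negligible against h; its
  -- normalised primitive is the ramp.
  set r : ℝ → ℝ := fun t => max 0 (min 1 (min ((t - s) / h ^ 2) ((s + h - t) / h ^ 2))) with hr
  have hrc : Continuous r := by fun_prop
  have hr0 : ∀ t, 0 ≤ r t := fun t => le_max_left _ _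
  have hr1 : ∀ t, r t ≤ 1 := fun t => max_le zero_le_one (min_le_left _ _)
  have hrout : ∀ t, t ∉ Ioo s (s + h) → r t = 0 := by
    intro t ht
    refine max_eq_left ?_
    rw [mem_Ioo, not_and_or, not_lt, not_lt] at ht
    rcases ht with ht | ht
    · exact (min_le_right _ _).trans ((min_le_left _ _).trans
        (div_nonpos_of_nonpos_of_nonneg (by linarith) (by positivity)))
    · exact (min_le_right _ _).trans ((min_le_right _ _).trans
        (div_nonpos_of_nonpos_of_nonneg (by linarith) (by positivity)))
  have hrmid : ∀ t, s + h ^ 2 ≤ t → t ≤ s + h - h ^ 2 → 1 ≤ r t := by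
    intro t ht ht'
    refine le_max_of_le_right (le_min le_rfl (le_min ?_ ?_)) <;>
    · rw [le_div_iff₀ (by positivity)]; linarith
  have hrl : ∀ x y, |r x - r y| ≤ (1 / h ^ 2) * |x - y| := by
    intro x y
    refine (abs_max_sub_max_le_max _ _ _ _).trans (max_le (by simp; positivity) ?_)
    refine (abs_min_sub_min_le_max _ _ _ _).trans (max_le (by simp; positivity) ?_)
    refine (abs_min_sub_min_le_max _ _ _ _).trans (max_le ?_ ?_)
    · rw [← sub_div, abs_div, abs_of_pos (a := h ^ 2) (by positivity), sub_sub_sub_cancel_right,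
        one_div_mul_eq_div]
    · rw [← sub_div, abs_div, abs_of_pos (a := h ^ 2) (by positivity), sub_sub_sub_cancel_left,
        one_div_mul_eq_div, abs_sub_comm]
  have hint : ∀ a b, IntervalIntegrable r volume a b := fun a b => hrc.intervalIntegrable a b
  have hh2 : h ^ 2 < h / 2 := by nlinarith
  set c := ∫ t in s..(s + h), r t with hc
  have hcge : h - 2 * h ^ 2 ≤ c := by
    have e : c = (∫ t in s..(s + h ^ 2), r t) + (∫ t in (s + h ^ 2)..(s + h - h ^ 2), r t)
        + ∫ t in (s + h - h ^ 2)..(s + h), r t := by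
      rw [intervalIntegral.integral_add_adjacent_intervals (hint _ _) (hint _ _),
        intervalIntegral.integral_add_adjacent_intervals (hint _ _) (hint _ _)]
    have e1 : 0 ≤ ∫ t in s..(s + h ^ 2), r t :=
      intervalIntegral.integral_nonneg (by nlinarith) fun t _ => hr0 t
    have e2 : 0 ≤ ∫ t in (s + h - h ^ 2)..(s + h), r t :=
      intervalIntegral.integral_nonneg (by nlinarith) fun t _ => hr0 t
    have e3 : ∫ t in (s + h ^ 2)..(s + h - h ^ 2), (1 : ℝ)
        ≤ ∫ t in (s + h ^ 2)..(s + h - h ^ 2), r t :=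
      intervalIntegral.integral_mono_on (by linarith) (by simp) (hint _ _)
        fun t ht => hrmid t ht.1 ht.2
    rw [intervalIntegral.integral_const, smul_eq_mul, mul_one] at e3
    linarith
  have hpos : 0 < h - 2 * h ^ 2 := by linarith
  have hc0 : 0 < c := by linarith
  have hlow : ∀ t, t ≤ s → ∫ x in s..t, r x = 0 := by
    intro t ht
    rw [intervalIntegral.integral_congr (g := fun _ => (0 : ℝ)), intervalIntegral.integral_zero]
    intro x hx
    rw [uIcc_of_ge ht] at hx
    exact hrout x fun hx' => absurd hx'.1 (not_lt.2 hx.2)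
  have hhigh : ∀ t, s + h ≤ t → ∫ x in s..t, r x = c := by
    intro t ht
    rw [← intervalIntegral.integral_add_adjacent_intervals (hint s (s + h)) (hint _ t), ← hc,
      intervalIntegral.integral_congr (g := fun _ => (0 : ℝ)) (a := s + h),
      intervalIntegral.integral_zero, add_zero]
    intro x hx
    rw [uIcc_of_le ht] at hx
    exact hrout x fun hx' => absurd hx'.2 (not_lt.2 hx.1)
  have hbd : ∀ t, 0 ≤ ∫ x in s..t, r x ∧ ∫ x in s..t, r x ≤ c := by
    intro t
    rcases le_total t s with ht | ht
    · rw [hlow t ht]; exact ⟨le_rfl, hc0.le⟩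
    · refine ⟨intervalIntegral.integral_nonneg ht fun t _ => hr0 t, ?_⟩
      rcases le_total t (s + h) with ht' | ht'
      · rw [hc, ← intervalIntegral.integral_add_adjacent_intervals (hint s t) (hint t (s + h))]
        have := intervalIntegral.integral_nonneg (μ := volume) ht' fun t _ => hr0 t
        linarith
      · exact (hhigh t ht').le
  refine ⟨fun t => -1 + 2 / c * ∫ x in s..t, r x, fun t => 2 / c * r t, fun t => ?_,
    ⟨2 / c * (1 / h ^ 2), fun x y => ?_⟩, fun t => ⟨by have := hr0 t; positivity, ?_⟩, fun t ht => ?_,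
    fun t => ?_, fun t ht => ?_, fun t ht => ?_⟩
  · exact ((intervalIntegral.integral_hasDerivAt_right (hint _ _)
      (hrc.stronglyMeasurableAtFilter _ _) hrc.continuousAt).const_mul _).const_add _
  · rw [← mul_sub, abs_mul, abs_of_pos (a := 2 / c) (by positivity), mul_assoc]
    gcongr
    exact hrl x y
  · calc 2 / c * r t ≤ 2 / c * 1 := by gcongr; exact hr1 t
      _ ≤ _ := by rw [mul_one]; gcongr
  · have : t ∉ Ioo s (s + h) := fun h => ht ⟨h.1, h.2.le⟩
    simp only [hrout t this, mul_zero]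
  · obtain ⟨ha, hb⟩ := hbd t
    have : 2 / c * ∫ x in s..t, r x ≤ 2 := by
      calc 2 / c * ∫ x in s..t, r x ≤ 2 / c * c := by gcongr
        _ = 2 := by field_simp
    have h3 : 0 ≤ 2 / c * ∫ x in s..t, r x := by positivity
    rw [abs_le]
    constructor <;> linarith
  · simp only [hlow t ht, mul_zero, add_zero]
  · simp only [hhigh t ht]
    field_simp
    norm_num

/-- The two-valued function which is `1` on the superlevel set `{u > s}` and `-1` elsewhere. -/
def phaseAbove (u : Torus d → ℝ) (s : ℝ) (x : Torus d) : ℝ := if s < u x then 1 else -1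

theorem phaseAbove_eq_or (u : Torus d → ℝ) (s : ℝ) (x : Torus d) :
    phaseAbove u s x = 1 ∨ phaseAbove u s x = -1 := by
  unfold phaseAbove
  split_ifs <;> simp

theorem measurable_phaseAbove {u : Torus d → ℝ} (hu : Measurable u) (s : ℝ) :
    Measurable (phaseAbove u s) :=
  Measurable.ite (measurableSet_lt measurable_const hu) measurable_const measurable_const

/-- The distribution function `t ↦ ∫_{a < u ≤ t} f`. -/
def sliceIntegral (u f : Torus d → ℝ) (a t : ℝ) : ℝ := ∫ x in u ⁻¹' Ioc a t, f x

theorem sliceIntegral_add {u f : Torus d → ℝ} (hu : Measurable u) (hf : Integrable f)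
    {a s t : ℝ} (h1 : a ≤ s) (h2 : s ≤ t) :
    sliceIntegral u f a t = sliceIntegral u f a s + sliceIntegral u f s t := by
  unfold sliceIntegral
  rw [← setIntegral_union _ (hu measurableSet_Ioc) hf.integrableOn hf.integrableOn,
    ← preimage_union, Ioc_union_Ioc_eq_Ioc h1 h2]
  exact Disjoint.preimage u (Ioc_disjoint_Ioc_of_le le_rfl)

theorem sliceIntegral_nonneg {u f : Torus d → ℝ} (hf : ∀ x, 0 ≤ f x) (a t : ℝ) :
    0 ≤ sliceIntegral u f a t := integral_nonneg fun x => hf x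

/-- The variation of the phase function is bounded by the density of the slice integral. -/
theorem IsWeakGradient.integral_phaseAbove_mul_div_le {u : Torus d → ℝ}
    {g : Fin d → Torus d → ℝ} (hum : Measurable u)
    (hu : MemLp u 2) (hg : IsWeakGradient u g) {w : ℝ → ℝ} (hw : Continuous w)
    (hwg : Integrable fun x => w (u x) * gradNorm g x)
    {a s F' : ℝ} (has : a ≤ s) (hws : 0 < w s)
    (hF : HasDerivAt (sliceIntegral u (fun x => w (u x) * gradNorm g x) a) F' s)
    {φ : Fin d → Torus d → ℝ} (hφ : (∀ i, IsSmooth (φ i)) ∧ ∀ x, ∑ i, φ i x ^ 2 ≤ 1) :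
    w s * ∫ x, phaseAbove u s x * ∑ i, pderiv i (φ i) x ≤ 2 * F' := by
  set f := fun x => w (u x) * gradNorm g x with hf
  have hg0 : ∀ x, 0 ≤ gradNorm g x := fun x => Real.sqrt_nonneg _
  set I := ∫ x, phaseAbove u s x * ∑ i, pderiv i (φ i) x
  have hdivc : Continuous fun x => ∑ i, pderiv i (φ i) x :=
    continuous_finsetSum _ fun i _ => ((hφ.1 i).pderiv i).continuous
  obtain ⟨C, hC⟩ := isCompact_univ.exists_bound_of_continuousOn hdivc.continuousOn
  -- The shift by 3 keeps h below 1/2, as the ramp requires.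
  let h : ℕ → ℝ := fun n => 1 / ((n : ℝ) + 3)
  have hh0 : ∀ n, 0 < h n := fun n => by positivity
  have hh1 : ∀ n, h n < 1 / 2 := fun n => by
    show 1 / ((n : ℝ) + 3) < 1 / 2
    rw [div_lt_div_iff₀ (by positivity) (by positivity)]
    have : (0 : ℝ) ≤ n := n.cast_nonneg
    linarith
  have hhlim : Tendsto h atTop (𝓝 0) := by
    have h1 : Tendsto (fun n : ℕ => (n : ℝ) + 3) atTop atTop :=
      tendsto_atTop_add_const_right _ _ tendsto_natCast_atTop_atTop
    simpa [h] using! h1.inv_tendsto_atTop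
  choose Φ ψ hΦ hℓ hψ hψ0 hΦ1 hΦl hΦr using fun n => exists_ramp s (hh0 n) (hh1 n)
  have hlimI : Tendsto (fun n => ∫ x, Φ n (u x) * ∑ i, pderiv i (φ i) x) atTop (𝓝 I) := by
    refine tendsto_integral_of_dominated_convergence (fun _ => C) (fun n => ?_)
      (integrable_const _) (fun n => ae_of_all _ fun x => ?_) (ae_of_all _ fun x => ?_)
    · have : Continuous (Φ n) := continuous_iff_continuousAt.2 fun t => (hΦ n t).continuousAt
      exact ((this.measurable.comp hum).aestronglyMeasurable).mul hdivc.aestronglyMeasurable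
    · rw [norm_mul]
      calc _ ≤ 1 * C := mul_le_mul (hΦ1 n _) (hC x (mem_univ x)) (norm_nonneg _) zero_le_one
        _ = C := one_mul C
    · refine Tendsto.mul_const _ ?_
      unfold phaseAbove
      split_ifs with hx
      · refine tendsto_const_nhds.congr' ?_
        have : ∀ᶠ n in atTop, h n < u x - s := hhlim.eventually_lt_const (by linarith)
        filter_upwards [this] with n hn
        exact (hΦr n _ (by linarith)).symm
      · exact tendsto_const_nhds.congr fun n => (hΦl n _ (not_lt.1 hx)).symm
  -- By continuity w exceeds any m < w(s) just above s, so m can be moved inside the integral over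
  -- the thin slice; m then tends to w(s).
  suffices H : ∀ m, 0 < m → m < w s → m * I ≤ 2 * F' by
    by_contra! hcon
    have hlt : Tendsto (fun m => m * I) (𝓝[<] (w s)) (𝓝 (w s * I)) :=
      ((continuous_mul_const I).tendsto _).mono_left nhdsWithin_le_nhds
    have h2 : ∀ᶠ m in 𝓝[<] (w s), 0 < m ∧ m < w s :=
      ((lt_mem_nhds hws).filter_mono nhdsWithin_le_nhds).and self_mem_nhdsWithin
    obtain ⟨m, hm1, hm2⟩ := ((hlt.eventually_const_lt hcon).and h2).exists
    exact absurd (H m hm2.1 hm2.2) (not_le.2 hm1)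
  intro m hm0 hm
  have hev : ∀ᶠ n in atTop, ∀ t ∈ Ioc s (s + h n), m ≤ w t := by
    obtain ⟨r, hr, hr'⟩ := Metric.eventually_nhds_iff.1 (hw.continuousAt.eventually (lt_mem_nhds hm))
    filter_upwards [hhlim.eventually_lt_const hr] with n hn t ht
    refine (hr' ?_).le
    rw [Real.dist_eq, abs_lt]
    constructor <;> linarith [ht.1, ht.2]
  -- The upper bound is a right difference quotient of the slice integral times a factor tending to
  -- 2, the jump of the phase function.
  have hq : Tendsto (fun n => 2 / (1 - 2 * h n) * ((h n)⁻¹ *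
      (sliceIntegral u f a (s + h n) - sliceIntegral u f a s))) atTop (𝓝 (2 * F')) := by
    have h1 : Tendsto (fun n => 2 / (1 - 2 * h n)) atTop (𝓝 2) := by
      have : Tendsto (fun n => 2 / (1 - 2 * h n)) atTop (𝓝 (2 / (1 - 2 * 0))) :=
        tendsto_const_nhds.div (tendsto_const_nhds.sub (hhlim.const_mul 2)) (by norm_num)
      simpa using this
    have h2 : Tendsto h atTop (𝓝[≠] 0) := tendsto_nhdsWithin_iff.2
      ⟨hhlim, .of_forall fun n => (hh0 n).ne'⟩
    exact h1.mul (by simpa [Function.comp_def] using hF.tendsto_slope_zero.comp h2)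
  refine le_of_tendsto_of_tendsto (hlimI.const_mul m) hq ?_
  filter_upwards [hev] with n hn
  obtain ⟨ℓ, hℓ⟩ := hℓ n
  have hne : h n - 2 * h n ^ 2 = h n * (1 - 2 * h n) := by ring
  have hpos : 0 < 1 - 2 * h n := by linarith [hh1 n]
  have key := hg.integral_comp_mul_div_le hu (hΦ n) (L := 2 / (h n - 2 * h n ^ 2))
    (fun t => by rw [abs_of_nonneg (hψ n t).1]; exact (hψ n t).2) hℓ (hΦ1 n) hφ
  have hslice : sliceIntegral u f a (s + h n) - sliceIntegral u f a s
      = sliceIntegral u f s (s + h n) := by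
    rw [sliceIntegral_add hum hwg has (by linarith [hh0 n] : s ≤ s + h n)]
    ring
  rw [hslice]
  calc m * ∫ x, Φ n (u x) * ∑ i, pderiv i (φ i) x
      ≤ m * ∫ x, |ψ n (u x)| * gradNorm g x := by gcongr
    _ = ∫ x, m * (|ψ n (u x)| * gradNorm g x) := by rw [integral_const_mul]
    _ ≤ ∫ x, (u ⁻¹' Ioc s (s + h n)).indicator (fun x => 2 / (h n - 2 * h n ^ 2) * f x) x := by
        refine integral_mono_of_nonneg (ae_of_all _ fun x => ?_)
          ((hwg.const_mul _).indicator (hum measurableSet_Ioc)) (ae_of_all _ fun x => ?_)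
        · have := hg0 x
          positivity
        · by_cases hx : u x ∈ Ioc s (s + h n)
          · rw [indicator_of_mem (by exact hx)]
            simp only [hf]
            rw [abs_of_nonneg (hψ n _).1]
            calc m * (ψ n (u x) * gradNorm g x) ≤ w (u x) * (2 / (h n - 2 * h n ^ 2) * gradNorm g x) := by
                  have h1 := hn _ hx
                  have h2 := (hψ n (u x)).1
                  have h3 := (hψ n (u x)).2
                  have := hg0 x
                  have h4 := hm0.le.trans h1
                  gcongr
              _ = _ := by ring
          · rw [indicator_of_notMem (by exact hx)]
            simp [hψ0 n _ hx]
    _ = 2 / (h n - 2 * h n ^ 2) * sliceIntegral u f s (s + h n) := by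
        rw [integral_indicator (hum measurableSet_Ioc), integral_const_mul]
        rfl
    _ = _ := by
        rw [hne]
        have := (hh0 n).ne'
        field_simp

/-- A coarea-type inequality: some superlevel set has perimeter at most the weighted average. -/
theorem IsWeakGradient.exists_totalVariation_phaseAbove_le {u : Torus d → ℝ}
    {g : Fin d → Torus d → ℝ} (hum : Measurable u)
    (hu : MemLp u 2) (hg : IsWeakGradient u g) {w : ℝ → ℝ} (hw : Continuous w)
    (hw0 : ∀ t, 0 ≤ w t) (hwg : Integrable fun x => w (u x) * gradNorm g x)
    {a b : ℝ} (hab : a < b) (hwab : ∀ t ∈ Ioo a b, 0 < w t) :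
    ∃ s ∈ Ioo a b, totalVariation (phaseAbove u s) ≠ ⊤ ∧
      (∫ t in a..b, w t) * (totalVariation (phaseAbove u s)).toReal
        ≤ 2 * ∫ x in u ⁻¹' Ioc a b, w (u x) * gradNorm g x := by
  set f := fun x => w (u x) * gradNorm g x with hf
  have hf0 : ∀ x, 0 ≤ f x := fun x => mul_nonneg (hw0 _) (Real.sqrt_nonneg _)
  set F := sliceIntegral u f a with hFdef
  have hmono : MonotoneOn F (uIcc a b) := by
    intro s hs t ht hst
    rw [uIcc_of_le hab.le] at hs
    rw [hFdef, sliceIntegral_add hum hwg hs.1 hst]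
    linarith [sliceIntegral_nonneg (u := u) hf0 s t]
  have hFa : F a = 0 := by simp [hFdef, sliceIntegral]
  -- Only an inequality is available for a monotone F, whose singular part is lost, but this is the
  -- direction needed.
  have hle : ∫ s in a..b, deriv F s ≤ F b := by
    have h1 := hmono.intervalIntegral_deriv_mem_uIcc
    have hFb : 0 ≤ F b := sliceIntegral_nonneg hf0 a b
    rw [hFa, sub_zero, uIcc_of_le hFb] at h1
    exact h1.2
  have hdi : IntervalIntegrable (deriv F) volume a b := hmono.intervalIntegrable_deriv
  have hwi : IntervalIntegrable w volume a b := hw.intervalIntegrable a b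
  have hwpos : 0 < ∫ t in a..b, w t :=
    intervalIntegral.intervalIntegral_pos_of_pos_on hwi hwab hab
  set l := F b / ∫ t in a..b, w t with hl
  have hdiff : ∀ᵐ s ∂(volume.restrict (Ioo a b)), DifferentiableAt ℝ F s := by
    have h1 := (hmono.mono (Ioo_subset_Icc_self.trans Icc_subset_uIcc)).ae_differentiableWithinAt
      measurableSet_Ioo
    filter_upwards [h1, ae_restrict_mem measurableSet_Ioo] with s hs hs'
    exact hs.differentiableAt (Ioo_mem_nhds hs'.1 hs'.2)
  -- Otherwise F' > l w almost everywhere, and integrating would contradict ∫ F' ≤ F(b) = l ∫ w.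
  have hex : ∃ s ∈ Ioo a b, DifferentiableAt ℝ F s ∧ deriv F s ≤ l * w s := by
    by_contra! hcon
    have hlt : ∀ᵐ s ∂(volume.restrict (Ioo a b)), l * w s < deriv F s := by
      filter_upwards [hdiff, ae_restrict_mem measurableSet_Ioo] with s hs hs' using hcon s hs' hs
    have hlt' : ∫ s in a..b, l * w s < ∫ s in a..b, deriv F s := by
      rw [← sub_pos, ← intervalIntegral.integral_sub hdi (hwi.const_mul l),
        intervalIntegral.integral_of_le hab.le, integral_Ioc_eq_integral_Ioo]
      have hpos : ∀ᵐ s ∂(volume.restrict (Ioo a b)), 0 < deriv F s - l * w s := by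
        filter_upwards [hlt] with s hs using sub_pos.2 hs
      rw [integral_pos_iff_support_of_nonneg_ae (hpos.mono fun s hs => hs.le)]
      · have : Function.support (fun s => deriv F s - l * w s) =ᵐ[volume.restrict (Ioo a b)] univ := by
          rw [eventuallyEq_univ]
          filter_upwards [hpos] with s hs using hs.ne'
        rw [measure_congr this]
        simp [hab]
      · have := (hdi.sub (hwi.const_mul l)).1
        exact this.mono_set Ioo_subset_Ioc_self
    rw [intervalIntegral.integral_const_mul, hl, div_mul_cancel₀ _ hwpos.ne'] at hlt'
    linarith
  obtain ⟨s, hs, hsd, hsl⟩ := hex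
  have hws := hwab s hs
  -- The level s was fixed before the test field, so the bound is uniform over the supremum.
  have hTV : totalVariation (phaseAbove u s) ≤ ENNReal.ofReal (2 * l) := by
    refine iSup₂_le fun φ hφ => ENNReal.ofReal_le_ofReal ?_
    have h1 := hg.integral_phaseAbove_mul_div_le hum hu hw hwg hs.1.le hws hsd.hasDerivAt hφ
    have h2 : w s * ∫ x, phaseAbove u s x * ∑ i, pderiv i (φ i) x ≤ w s * (2 * l) := by linarith
    exact le_of_mul_le_mul_left h2 hws
  refine ⟨s, hs, ne_top_of_le_ne_top ENNReal.ofReal_ne_top hTV, ?_⟩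
  have hl0 : 0 ≤ l := div_nonneg (sliceIntegral_nonneg hf0 a b) hwpos.le
  have h3 := ENNReal.toReal_mono ENNReal.ofReal_ne_top hTV
  rw [ENNReal.toReal_ofReal (by positivity)] at h3
  calc _ ≤ (∫ t in a..b, w t) * (2 * l) := by gcongr
    _ = 2 * F b := by rw [hl]; field_simp
    _ = _ := rfl

/-! ### Quantitative bounds on the double-well potential. -/

namespace IsDoubleWell

variable {W : ℝ → ℝ}

theorem apply_one (hW : IsDoubleWell d W) : W 1 = 0 := (hW.eq_zero_iff 1).2 (Or.inl rfl)

theorem deriv_one (hW : IsDoubleWell d W) : deriv W 1 = 0 := by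
  refine IsLocalMin.deriv_eq_zero (.of_forall fun x => ?_)
  rw [hW.apply_one]
  exact hW.nonneg x

/-- Near the well at `1` the potential is bounded below by its quadratic approximation. -/
theorem exists_quadratic_lower_bound (hW : IsDoubleWell d W) :
    ∃ M : ℝ, 0 < M ∧ ∀ δ : ℝ, 0 ≤ δ → δ ≤ 1 → ∀ r, |r - 1| ≤ δ →
      (1 - M * δ) * (deriv (deriv W) 1 / 2 * (r - 1) ^ 2) ≤ W r := by
  set A := deriv (deriv W) 1 with hA
  have hA0 : 0 < A := hW.second_deriv_pos
  have hc1 : ContDiff ℝ 2 (deriv W) := (contDiff_succ_iff_deriv (n := 2).1 (by simpa using! hW.contDiff)).2.2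
  have hc2 : ContDiff ℝ 1 (deriv (deriv W)) := (contDiff_succ_iff_deriv (n := 1).1 (by simpa using! hc1)).2.2
  have hc3 : Continuous (deriv (deriv (deriv W))) := hc2.continuous_deriv le_rfl
  obtain ⟨L, hL⟩ := isCompact_Icc.exists_bound_of_continuousOn (s := Icc (0 : ℝ) 2) hc3.continuousOn
  have hL0 : 0 ≤ L := (norm_nonneg _).trans (hL 1 (by norm_num))
  have hlip : ∀ ξ ∈ Icc (0 : ℝ) 2, |deriv (deriv W) ξ - A| ≤ L * |ξ - 1| := by
    intro ξ hξ
    exact Convex.norm_image_sub_le_of_norm_deriv_le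
      (fun x _ => hc2.differentiable (by norm_num) x) hL (convex_Icc 0 2) (by norm_num) hξ
  -- L bounds |W'''| on [0, 2], so W'' drops below A by at most Lδ near 1; the extra 1 keeps the
  -- constant positive.
  refine ⟨L / A + 1, by positivity, fun δ h0 h1 r hr => ?_⟩
  rcases eq_or_ne r 1 with rfl | hne
  · simpa using hW.nonneg 1
  obtain ⟨ξ, hξ, h⟩ := taylor_mean_remainder_lagrange_iteratedDeriv (n := 1) (f := W) hne.symm
    ((hW.contDiff.of_le (by norm_num)).contDiffOn)
  have hud : UniqueDiffWithinAt ℝ (uIcc 1 r) 1 :=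
    uniqueDiffOn_uIcc hne.symm 1 left_mem_uIcc
  have htay : taylorWithinEval W 1 (uIcc 1 r) 1 r = 0 := by
    rw [taylorWithinEval_succ, taylor_within_zero_eval, iteratedDerivWithin_one,
      (hW.contDiff.differentiable (by norm_num) 1).derivWithin hud, hW.deriv_one, hW.apply_one]
    simp
  have hit : iteratedDeriv 2 W ξ = deriv (deriv W) ξ := by
    rw [iteratedDeriv_succ, iteratedDeriv_one]
  rw [htay, sub_zero, one_add_one_eq_two, hit] at h
  have hξ1 : |ξ - 1| ≤ δ := by
    refine le_trans ?_ hr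
    have := uIoo_subset_uIcc_self hξ
    exact abs_sub_left_of_mem_uIcc this
  have hξ2 : ξ ∈ Icc (0 : ℝ) 2 := by
    have := abs_le.1 (hξ1.trans h1)
    constructor <;> linarith
  have h3 := abs_le.1 ((hlip ξ hξ2).trans (mul_le_mul_of_nonneg_left hξ1 hL0))
  rw [h]
  have h4 : (1 - (L / A + 1) * δ) * A ≤ deriv (deriv W) ξ := by
    have : (1 - (L / A + 1) * δ) * A = A - L * δ - δ * A := by field_simp; ring
    have := mul_nonneg h0 hA0.le
    linarith [h3.1]
  have h5 : 0 ≤ (r - 1) ^ 2 := sq_nonneg _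
  norm_num [Nat.factorial]
  nlinarith

/-- At distance at least δ₁ from the wells W has a positive minimum by compactness. Closer in, the
quadratic bound applies, and Mδ₁ ≤ 1/2 turns its constant A/2 into A/4. Evenness covers negative r.
-/
theorem exists_transition_lower_bound (hW : IsDoubleWell d W) :
    ∃ c δ₁ : ℝ, 0 < c ∧ 0 < δ₁ ∧ ∀ δ : ℝ, 0 < δ → δ ≤ δ₁ → ∀ r, |r| ≤ 1 - δ → c * δ ^ 2 ≤ W r := by
  obtain ⟨M, hM, hq⟩ := hW.exists_quadratic_lower_bound
  set A := deriv (deriv W) 1 with hA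
  have hA0 : 0 < A := hW.second_deriv_pos
  set δ₁ := min 1 (1 / (2 * M)) with hδ₁
  have hδ₁0 : 0 < δ₁ := by positivity
  have hδ₁1 : δ₁ ≤ 1 := min_le_left _ _
  have hMδ : M * δ₁ ≤ 1 / 2 := by
    calc M * δ₁ ≤ M * (1 / (2 * M)) := by gcongr; exact min_le_right _ _
      _ = 1 / 2 := by field_simp
  have hcont : Continuous W := hW.contDiff.continuous
  have hK : IsCompact (Icc (-(1 - δ₁)) (1 - δ₁)) := isCompact_Icc
  have hKne : (Icc (-(1 - δ₁)) (1 - δ₁)).Nonempty := ⟨0, by constructor <;> linarith⟩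
  obtain ⟨r₀, hr₀, hmin⟩ := hK.exists_isMinOn hKne hcont.continuousOn
  have hm0 : 0 < W r₀ := by
    refine lt_of_le_of_ne (hW.nonneg _) fun h => ?_
    rcases (hW.eq_zero_iff r₀).1 h.symm with h | h <;> rw [h] at hr₀ <;>
      linarith [hr₀.1, hr₀.2]
  refine ⟨min (W r₀) (A / 4), δ₁, by positivity, hδ₁0, fun δ h0 h1 r hr => ?_⟩
  have key : ∀ r, 0 ≤ r → r ≤ 1 - δ → min (W r₀) (A / 4) * δ ^ 2 ≤ W r := by
    intro r hr0 hr
    have hδ1 : δ ≤ 1 := h1.trans hδ₁1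
    rcases le_total r (1 - δ₁) with h | h
    · calc min (W r₀) (A / 4) * δ ^ 2 ≤ W r₀ * 1 := by
            gcongr
            · exact min_le_left _ _
            · exact pow_le_one₀ h0.le hδ1
        _ ≤ W r := by rw [mul_one]; exact hmin ⟨by linarith, h⟩
    · have h2 := hq δ₁ hδ₁0.le hδ₁1 r (by rw [abs_le]; constructor <;> linarith)
      refine le_trans ?_ h2
      calc min (W r₀) (A / 4) * δ ^ 2 ≤ A / 4 * (r - 1) ^ 2 := by
            gcongr ?_ * ?_
            · exact min_le_right _ _
            · nlinarith
        _ = 1 / 2 * (A / 2 * (r - 1) ^ 2) := by ring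
        _ ≤ _ := by gcongr; linarith
  rw [abs_le] at hr
  rcases le_total 0 r with h | h
  · exact key r h hr.2
  · rw [← hW.even r]
    exact key (-r) (by linarith) (by linarith)

/-- Shortening the interval [-1, 1] by δ at each end loses at most δ sup √(2W) per end from the
normalised total 1. -/
theorem exists_tension_lower_bound (hW : IsDoubleWell d W) :
    ∃ N : ℝ, 0 < N ∧ ∀ δ : ℝ, 0 ≤ δ → δ ≤ 1 →
      1 - N * δ ≤ ∫ s in (-1 + δ)..(1 - δ), √(2 * W s) := by
  have hc : Continuous fun s => √(2 * W s) := by have := hW.contDiff.continuous; fun_prop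
  obtain ⟨M, hM⟩ := isCompact_Icc.exists_bound_of_continuousOn (s := Icc (-1 : ℝ) 1) hc.continuousOn
  have hM0 : 0 ≤ M := (norm_nonneg _).trans (hM 1 (by norm_num))
  refine ⟨2 * M + 1, by positivity, fun δ h0 h1 => ?_⟩
  have hi : ∀ a b, IntervalIntegrable (fun s => √(2 * W s)) volume a b :=
    fun a b => hc.intervalIntegrable a b
  have hsum : (1 : ℝ) = (∫ s in (-1 : ℝ)..(-1 + δ), √(2 * W s))
      + (∫ s in (-1 + δ)..(1 - δ), √(2 * W s)) + ∫ s in (1 - δ)..1, √(2 * W s) := by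
    rw [intervalIntegral.integral_add_adjacent_intervals (hi _ _) (hi _ _),
      intervalIntegral.integral_add_adjacent_intervals (hi _ _) (hi _ _), hW.normalised]
  have b1 : ‖∫ s in (-1 : ℝ)..(-1 + δ), √(2 * W s)‖ ≤ M * |(-1 + δ) - (-1)| :=
    intervalIntegral.norm_integral_le_of_norm_le_const fun x hx => by
      rw [uIoc_of_le (by linarith)] at hx
      exact hM x ⟨by linarith [hx.1], by linarith [hx.2]⟩
  have b2 : ‖∫ s in (1 - δ)..1, √(2 * W s)‖ ≤ M * |1 - (1 - δ)| :=
    intervalIntegral.norm_integral_le_of_norm_le_const fun x hx => by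
      rw [uIoc_of_le (by linarith)] at hx
      exact hM x ⟨by linarith [hx.1], by linarith [hx.2]⟩
  rw [show (-1 + δ) - (-1) = δ by ring, abs_of_nonneg h0] at b1
  rw [show 1 - (1 - δ) = δ by ring, abs_of_nonneg h0] at b2
  have b3 := (le_abs_self _).trans b1
  have b4 := (le_abs_self _).trans b2
  nlinarith

end IsDoubleWell

/-! ### Comparison of Coulomb and screened energies mode by mode. -/

theorem coeff_add {f g : Torus d → ℝ} (hf : Integrable f) (hg : Integrable g)
    (k : Fin d → ℤ) : coeff (fun x => f x + g x) k = coeff f k + coeff g k := by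
  unfold coeff
  rw [← integral_add (integrable_mFourier_mul hf (-k))
    (integrable_mFourier_mul hg (-k))]
  congr with x
  push_cast
  ring

theorem coeff_sub {f g : Torus d → ℝ} (hf : Integrable f) (hg : Integrable g)
    (k : Fin d → ℤ) : coeff (fun x => f x - g x) k = coeff f k - coeff g k := by
  unfold coeff
  rw [← integral_sub (integrable_mFourier_mul hf (-k))
    (integrable_mFourier_mul hg (-k))]
  congr with x
  push_cast
  ring

theorem norm_coeff_le (f : Torus d → ℝ) (k : Fin d → ℤ) : ‖coeff f k‖ ≤ ∫ x, |f x| := by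
  refine (norm_integral_le_integral_norm _).trans_eq ?_
  congr with x
  rw [norm_mul, norm_mFourier_apply, one_mul, Complex.norm_real, Real.norm_eq_abs]

theorem hasSum_nonlocal {K f : Torus d → ℝ} (hK : Integrable K) {m : (Fin d → ℤ) → ℝ}
    (hm : ∀ k, coeff K k = m k) (hf : MemLp f 2) {M : ℝ} (hM : ∀ᵐ x, |f x| ≤ M) :
    HasSum (fun k => m k * ‖coeff f k‖ ^ 2) (∫ x, f x * conv K f x) := by
  convert hasSum_integral_mul_conv hK hm hf hM hf using 3 with k
  rw [← Complex.normSq_eq_conj_mul_self, Complex.ofReal_re, Complex.normSq_eq_norm_sq]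

theorem nonlocal_nonneg {K f : Torus d → ℝ} (hK : Integrable K) {m : (Fin d → ℤ) → ℝ}
    (hm : ∀ k, coeff K k = m k) (hm0 : ∀ k, 0 ≤ m k) (hf : MemLp f 2) {M : ℝ}
    (hM : ∀ᵐ x, |f x| ≤ M) : 0 ≤ ∫ x, f x * conv K f x :=
  (hasSum_nonlocal hK hm hf hM).nonneg fun k => mul_nonneg (hm0 k) (sq_nonneg _)

theorem sq_le_freq (k : Fin d → ℤ) (i : Fin d) : (k i : ℝ) ^ 2 ≤ freq k := by
  unfold freq
  have h1 : (k i : ℝ) ^ 2 ≤ ∑ j, (k j : ℝ) ^ 2 :=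
    Finset.single_le_sum (f := fun j => (k j : ℝ) ^ 2) (fun _ _ => sq_nonneg _) (Finset.mem_univ i)
  have h2 : (1 : ℝ) ≤ 4 * Real.pi ^ 2 := by nlinarith [Real.pi_gt_three]
  nlinarith [sq_nonneg (k i : ℝ)]

theorem inv_freq_le_one (k : Fin d → ℤ) : (freq k)⁻¹ ≤ 1 := by
  by_cases hk : k = 0
  · rw [freq_eq_zero_iff.2 hk, inv_zero]; exact zero_le_one
  obtain ⟨i, hi⟩ := Function.ne_iff.1 hk
  refine inv_le_one_of_one_le₀ (le_trans ?_ (sq_le_freq k i))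
  have : (1 : ℤ) ≤ (k i) ^ 2 := by
    have : (0 : ℤ) < (k i) ^ 2 := by simpa [sq_pos_iff] using hi
    omega
  exact_mod_cast this

theorem inv_freq_le_of_notMem_box {N : ℕ} (hN : 0 < N) {k : Fin d → ℤ}
    (hk : k ∉ Finset.Icc (fun _ : Fin d => -(N : ℤ)) (fun _ => (N : ℤ))) :
    (freq k)⁻¹ ≤ ((N : ℝ) ^ 2)⁻¹ := by
  have : ∃ i, (N : ℤ) < |k i| := by
    by_contra! h
    refine hk (Finset.mem_Icc.2 ⟨fun i => (abs_le.1 (h i)).1, fun i => (abs_le.1 (h i)).2⟩)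
  obtain ⟨i, hi⟩ := this
  refine inv_anti₀ (by positivity) (le_trans ?_ (sq_le_freq k i))
  have h1 : (N : ℝ) ≤ |(k i : ℝ)| := by exact_mod_cast hi.le
  rw [← sq_abs (k i : ℝ)]
  gcongr

/-- Interpolation bound for the Coulomb self-energy by splitting frequencies at `N`. -/
theorem IsCoulombKernel.nonlocal_le {G₀ p : Torus d → ℝ} (hG : IsCoulombKernel G₀)
    (hp : MemLp p 2) {M : ℝ} (hM : ∀ᵐ x, |p x| ≤ M) {N : ℕ} (hN : 0 < N) :
    ∫ x, p x * conv G₀ p x ≤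
      (2 * N + 1) ^ d * (∫ x, |p x|) ^ 2 + ((N : ℝ) ^ 2)⁻¹ * ∫ x, p x ^ 2 := by
  set B := Finset.Icc (fun _ : Fin d => -(N : ℤ)) (fun _ => (N : ℤ)) with hB
  have h1 := hasSum_nonlocal hG.1 hG.coeff_eq hp hM
  have h2 := (hasSum_sq_coeff hp).mul_left ((N : ℝ) ^ 2)⁻¹
  have h3 : HasSum (fun k => if k ∈ B then (∫ x, |p x|) ^ 2 else 0)
      ((2 * N + 1) ^ d * (∫ x, |p x|) ^ 2) := by
    have h := hasSum_sum_of_ne_finset_zero (f := fun k => if k ∈ B then (∫ x, |p x|) ^ 2 else 0)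
      (s := B) (L := SummationFilter.unconditional _) (fun k hk => if_neg hk)
    convert h using 1
    rw [Finset.sum_ite_mem, Finset.inter_self, Finset.sum_const, hB, Pi.card_Icc, nsmul_eq_mul]
    simp only [Int.card_Icc, Finset.prod_const, Finset.card_univ, Fintype.card_fin]
    congr 1
    have : ((N : ℤ) + 1 - -(N : ℤ)).toNat = 2 * N + 1 := by omega
    rw [this]
    push_cast
    rfl
  refine hasSum_le (fun k => ?_) h1 (h3.add h2)
  have hc := norm_coeff_le p k
  have hi := inv_freq_le_one k
  by_cases hk : k ∈ B
  · simp only [if_pos hk]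
    have : (freq k)⁻¹ * ‖coeff p k‖ ^ 2 ≤ 1 * (∫ x, |p x|) ^ 2 := by gcongr
    have h4 : 0 ≤ ((N : ℝ) ^ 2)⁻¹ * ‖coeff p k‖ ^ 2 := by positivity
    linarith
  · simp only [if_neg hk, zero_add]
    exact mul_le_mul_of_nonneg_right (inv_freq_le_of_notMem_box hN hk) (sq_nonneg _)

/-- Mode-by-mode minimisation of the quadratic energy, nonzero modes. -/
theorem mode_bound_of_pos {A l : ℝ} (hA : 0 < A) (hl : 0 < l) (z b : ℂ) :
    (l + A⁻¹)⁻¹ * ‖b‖ ^ 2 ≤ A * ‖z - b‖ ^ 2 + l⁻¹ * ‖z‖ ^ 2 := by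
  rw [← Complex.normSq_eq_norm_sq, ← Complex.normSq_eq_norm_sq, ← Complex.normSq_eq_norm_sq]
  simp only [Complex.normSq_apply, Complex.sub_re, Complex.sub_im]
  -- Completing the square: the minimiser is x = lAy/(lA + 1).
  have key : ∀ x y : ℝ, (l + A⁻¹)⁻¹ * (y * y) ≤ A * ((x - y) * (x - y)) + l⁻¹ * (x * x) := by
    intro x y
    have : A * ((x - y) * (x - y)) + l⁻¹ * (x * x) - (l + A⁻¹)⁻¹ * (y * y)
        = (l * A + 1)⁻¹ * l⁻¹ * ((l * A + 1) * x - l * A * y) ^ 2 := by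
      field_simp
      ring
    have h2 : 0 ≤ (l * A + 1)⁻¹ * l⁻¹ * ((l * A + 1) * x - l * A * y) ^ 2 := by positivity
    linarith
  have h1 := key z.re b.re
  have h2 := key z.im b.im
  linarith

/-- Polarisation, used to separate the Coulomb energy of f + p into self-energies and the
interaction of p with the potential of f. -/
theorem norm_add_sq_eq (z p : ℂ) :
    ‖z + p‖ ^ 2 = ‖z‖ ^ 2 + 2 * (conj p * z).re + ‖p‖ ^ 2 := by
  rw [← Complex.normSq_eq_norm_sq, ← Complex.normSq_eq_norm_sq, ← Complex.normSq_eq_norm_sq]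
  simp only [Complex.normSq_apply, Complex.add_re, Complex.add_im, Complex.mul_re, Complex.conj_re,
    Complex.conj_im]
  ring

/-- The Coulomb energy does not see the mode 0, where the screened multiplier equals A. There f̂ =
0, and Young's inequality with weight δ absorbs the cross term of |p̂ - b̂|². -/
theorem mode_bound_zero {δ : ℝ} (h0 : 0 < δ) (p b : ℂ) :
    (1 - δ) * ‖b‖ ^ 2 ≤ ‖p - b‖ ^ 2 + δ⁻¹ * ‖p‖ ^ 2 := by
  rw [← Complex.normSq_eq_norm_sq, ← Complex.normSq_eq_norm_sq, ← Complex.normSq_eq_norm_sq]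
  simp only [Complex.normSq_apply, Complex.sub_re, Complex.sub_im]
  have key : ∀ x y : ℝ, (1 - δ) * (y * y) ≤ (x - y) * (x - y) + δ⁻¹ * (x * x) := by
    intro x y
    have : (x - y) * (x - y) + δ⁻¹ * (x * x) - (1 - δ) * (y * y)
        = x ^ 2 + δ⁻¹ * (x - δ * y) ^ 2 := by
      field_simp
      ring
    have h2 : 0 ≤ x ^ 2 + δ⁻¹ * (x - δ * y) ^ 2 := by positivity
    linarith
  have h1 := key p.re b.re
  have h2 := key p.im b.im
  linarith

/-- Comparison of the Coulomb energy plus a quadratic bulk term with the screened energy. -/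
theorem nonlocal_comparison {G₀ G f p b : Torus d → ℝ} {κ A δ : ℝ} (hA : 0 < A) (hκ : κ ^ 2 = A⁻¹)
    (hδ0 : 0 < δ) (hG₀ : IsCoulombKernel G₀) (hG : IsScreenedKernel κ G)
    (hf : MemLp f 2) (hp : MemLp p 2) (hb : MemLp b 2) {M : ℝ} (hfM : ∀ᵐ x, |f x| ≤ M)
    (hpM : ∀ᵐ x, |p x| ≤ M) (hbM : ∀ᵐ x, |b x| ≤ M) (hf0 : ∫ x, f x = 0) :
    (1 - δ) * ∫ x, b x * conv G b x ≤
      A * (∫ x, (f x + p x - b x) ^ 2) + (∫ x, f x * conv G₀ f x)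
        + 2 * (∫ x, p x * conv G₀ f x) + (∫ x, p x * conv G₀ p x)
        + A * δ⁻¹ * (∫ x, |p x|) ^ 2 := by
  have hκ0 : κ ≠ 0 := by
    rintro rfl
    have := inv_pos.2 hA
    rw [← hκ] at this
    simp at this
  have hfi := hf.integrable one_le_two
  have hpi := hp.integrable one_le_two
  have hbi := hb.integrable one_le_two
  have s0 := (hasSum_nonlocal hG.1 (hG.coeff_eq hκ0) hb hbM).mul_left (1 - δ)
  have s1 := (hasSum_sq_coeff ((hf.add hp).sub hb)).mul_left A
  have s2 := hasSum_nonlocal hG₀.1 hG₀.coeff_eq hf hfM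
  have s3 := (hasSum_integral_mul_conv hG₀.1 hG₀.coeff_eq hf hfM hp).mul_left 2
  have s4 := hasSum_nonlocal hG₀.1 hG₀.coeff_eq hp hpM
  have s5 : HasSum (fun k : Fin d → ℤ => if k = 0 then A * δ⁻¹ * (∫ x, |p x|) ^ 2 else 0)
      (A * δ⁻¹ * (∫ x, |p x|) ^ 2) := hasSum_ite_eq 0 _
  refine hasSum_le (fun k => ?_) s0 ((((s1.add s2).add s3).add s4).add s5)
  have hco : coeff (f + p - b) k = coeff f k + coeff p k - coeff b k := by
    have h1 := coeff_sub (hfi.add hpi) hbi k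
    have h2 := coeff_add hfi hpi k
    calc coeff (f + p - b) k = coeff (f + p) k - coeff b k := h1
      _ = _ := by rw [← h2]; rfl
  rw [hco, hκ]
  by_cases hk : k = 0
  · subst hk
    have hz : coeff f 0 = 0 := by rw [coeff_zero, hf0, Complex.ofReal_zero]
    have h1 := mul_le_mul_of_nonneg_left (mode_bound_zero hδ0 (coeff p 0) (coeff b 0)) hA.le
    have h2 : A * δ⁻¹ * ‖coeff p 0‖ ^ 2 ≤ A * δ⁻¹ * (∫ x, |p x|) ^ 2 := by
      gcongr
      exact norm_coeff_le p 0
    rw [freq_eq_zero_iff.2 rfl, hz]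
    simp only [if_true, zero_add, inv_zero, zero_mul, mul_zero, add_zero, inv_inv]
    linarith
  · have hl : 0 < freq k := lt_of_le_of_ne (freq_nonneg k) fun h => hk (freq_eq_zero_iff.1 h.symm)
    -- The free variable is f̂ + p̂, the transform of the bulk-corrected profile.
    have h1 := mode_bound_of_pos hA hl (coeff f k + coeff p k) (coeff b k)
    have h2 : 0 ≤ δ * ((freq k + A⁻¹)⁻¹ * ‖coeff b k‖ ^ 2) := by positivity
    rw [norm_add_sq_eq (coeff f k) (coeff p k)] at h1
    simp only [if_neg hk]
    linarith

theorem nonlocalEnergy_eq (K : Torus d → ℝ) (ubar : ℝ) (u : Torus d → ℝ) :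
    nonlocalEnergy K ubar u
      = 1 / 2 * ∫ x, (u x - ubar) * conv K (fun y => u y - ubar) x := by
  simp only [nonlocalEnergy, conv, mul_assoc, integral_const_mul]

/-! ### Absorbing the remainders. -/

/-- The frequency cut-off is chosen of order `σ⁻³` to absorb all remainders. -/
theorem exists_cutoff_error_le (d : ℕ) {σ c A τ : ℝ} (hσ0 : 0 < σ) (hσ1 : σ ≤ 1) (hc : 0 < c)
    (hA : 0 < A) (hτ0 : 0 ≤ τ) (hτ : c * σ ^ 4 * τ ≤ (σ ^ 3) ^ (d + 6)) :
    ∃ N : ℕ, 0 < N ∧ (2 * (N : ℝ) + 1) ^ d * (2 * τ) ^ 2 + ((N : ℝ) ^ 2)⁻¹ * (4 * τ)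
      + A * (σ ^ 2)⁻¹ * (2 * τ) ^ 2 ≤ (4 * 5 ^ d / c + 4 + 4 * A / c) * (σ ^ 6 * τ) := by
  set t := σ ^ 3 with ht
  have ht0 : 0 < t := by positivity
  have ht1 : t ≤ 1 := pow_le_one₀ hσ0.le hσ1
  have htinv : 1 ≤ t⁻¹ := (one_le_inv₀ ht0).2 ht1
  refine ⟨⌈t⁻¹⌉₊, Nat.ceil_pos.2 (by positivity), ?_⟩
  set N : ℝ := (⌈t⁻¹⌉₊ : ℝ) with hN
  have hN1 : t⁻¹ ≤ N := Nat.le_ceil _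
  have hN2 : N < t⁻¹ + 1 := Nat.ceil_lt_add_one (by positivity)
  have hN0 : 0 < N := by linarith
  have h1 : (2 * N + 1) ^ d ≤ 5 ^ d * (t⁻¹) ^ d := by
    rw [← mul_pow]
    gcongr
    linarith
  -- In the exponent d + 6, the d pays for the number of low modes and the 6 leaves t⁶ = σ¹⁸, more
  -- than the σ¹⁰ needed.
  have h2 : (t⁻¹) ^ d * τ ≤ σ ^ 6 / c := by
    rw [le_div_iff₀ hc]
    have h3 : (t⁻¹) ^ d * τ * c * σ ^ 4 ≤ t ^ 6 := by
      calc (t⁻¹) ^ d * τ * c * σ ^ 4 = (t⁻¹) ^ d * (c * σ ^ 4 * τ) := by ring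
        _ ≤ (t⁻¹) ^ d * t ^ (d + 6) := by gcongr
        _ = t ^ 6 := by rw [pow_add, ← mul_assoc, ← mul_pow, inv_mul_cancel₀ ht0.ne', one_pow, one_mul]
    have h4 : t ^ 6 ≤ σ ^ 6 * σ ^ 4 := by
      rw [ht, ← pow_mul, ← pow_add]
      exact pow_le_pow_of_le_one hσ0.le hσ1 (by norm_num)
    exact le_of_mul_le_mul_right (h3.trans h4) (by positivity)
  have h5 : (2 * N + 1) ^ d * (2 * τ) ^ 2 ≤ 4 * 5 ^ d / c * (σ ^ 6 * τ) := by
    calc (2 * N + 1) ^ d * (2 * τ) ^ 2 ≤ 5 ^ d * (t⁻¹) ^ d * (2 * τ) ^ 2 := by gcongr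
      _ = 4 * 5 ^ d * τ * ((t⁻¹) ^ d * τ) := by ring
      _ ≤ 4 * 5 ^ d * τ * (σ ^ 6 / c) := by gcongr
      _ = _ := by ring
  have h6 : (N ^ 2)⁻¹ * (4 * τ) ≤ 4 * (σ ^ 6 * τ) := by
    have : (N ^ 2)⁻¹ ≤ t ^ 2 := by
      rw [← inv_pow]
      gcongr
      exact inv_le_of_inv_le₀ ht0 hN1
    calc (N ^ 2)⁻¹ * (4 * τ) ≤ t ^ 2 * (4 * τ) := by gcongr
      _ = _ := by rw [ht]; ring
  have h7 : A * (σ ^ 2)⁻¹ * (2 * τ) ^ 2 ≤ 4 * A / c * (σ ^ 6 * τ) := by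
    have h8 : (σ ^ 2)⁻¹ * τ ≤ σ ^ 6 / c := by
      rw [le_div_iff₀ hc, mul_assoc, inv_mul_le_iff₀ (by positivity)]
      have h9 : t ^ (d + 6) ≤ σ ^ 4 * (σ ^ 2 * σ ^ 6) := by
        rw [ht, ← pow_mul, ← pow_add, ← pow_add]
        exact pow_le_pow_of_le_one hσ0.le hσ1 (by omega)
      have h10 : σ ^ 4 * (τ * c) ≤ σ ^ 4 * (σ ^ 2 * σ ^ 6) := by linarith
      exact le_of_mul_le_mul_left h10 (by positivity)
    calc A * (σ ^ 2)⁻¹ * (2 * τ) ^ 2 = 4 * A * τ * ((σ ^ 2)⁻¹ * τ) := by ring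
      _ ≤ 4 * A * τ * (σ ^ 6 / c) := by gcongr
      _ = _ := by ring
  linarith

/-- Here σ = √δ, P is the perimeter term, J twice the screened energy, I₁ and I₂ the local energies
on and off T, Q the squared bulk deviation, N₀ twice the Coulomb energy, R the remainder and τ =
|T|. Every relative loss is a multiple of σ², and one spare factor σ makes the constants harmless.
-/
theorem energy_bookkeeping {σ A M N c C E P J I₁ I₂ Q N₀ R τ : ℝ} (hσ0 : 0 < σ)
    (hM : 0 < M) (hN : 0 < N) (hc : 0 < c) (hC : 0 < C) (hMσ : M * σ ^ 2 ≤ 1)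
    (hσ : (N + M + 1 + C / (2 * c)) * σ ≤ 1) (hP : 0 ≤ P) (hJ : 0 ≤ J)
    (hN₀ : 0 ≤ N₀) (hτ : 0 ≤ τ) (hE : E = I₁ + I₂ + N₀ / 2)
    (h1 : (1 - N * σ ^ 2) * P ≤ I₁) (h2 : (1 - M * σ ^ 2) * (A / 2 * Q) ≤ I₂)
    (h3 : (1 - σ ^ 2) * J ≤ A * Q + N₀ + R) (hR : R ≤ C * (σ ^ 6 * τ))
    (h4 : c * (σ ^ 2) ^ 2 * τ ≤ E) : (1 - σ) * (P + 1 / 2 * J) ≤ E := by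
  set D := C / (2 * c) with hD
  have hD0 : 0 < D := by positivity
  have hRE : R / 2 ≤ D * σ ^ 2 * E := by
    calc R / 2 ≤ C * (σ ^ 6 * τ) / 2 := by linarith
      _ = D * σ ^ 2 * (c * (σ ^ 2) ^ 2 * τ) := by rw [hD]; field_simp
      _ ≤ _ := by gcongr
  have hm0 : 0 ≤ 1 - M * σ ^ 2 := by linarith
  have hE0 : 0 ≤ E := le_trans (by positivity) h4
  set y := σ ^ 2 with hy
  have hy0 : 0 < y := by positivity
  -- Since N₀ ≥ 0, the factor 1 - My can be imposed on it as well, so that bulk and Coulomb terms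
  -- carry the common weight needed for the comparison.
  have h5 : (1 - M * y) * ((1 - y) * J / 2 - R / 2) ≤ I₂ + N₀ / 2 := by
    have e1 : (1 - M * y) * ((1 - y) * J / 2 - R / 2) ≤ (1 - M * y) * (A / 2 * Q + N₀ / 2) := by
      gcongr
      linarith
    have e2 : 0 ≤ M * y * (N₀ / 2) := by positivity
    linarith
  have h6 : (1 - M * y) * (R / 2) ≤ D * y * E := by
    have e1 : (1 - M * y) * (R / 2) ≤ (1 - M * y) * (D * y * E) := by gcongr
    have e2 : 0 ≤ M * y * (D * y * E) := by positivity
    linarith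
  have h7 : (1 - (N + M + 1) * y) * (P + 1 / 2 * J) ≤ (1 + D * y) * E := by
    have e1 : 0 ≤ (M + 1) * y * P := by positivity
    have e2 : 0 ≤ N * y * J := by positivity
    have e3 : 0 ≤ M * y * y * J := by positivity
    have e4 : (1 - M * y) * ((1 - y) * J / 2) - (1 - M * y) * (R / 2) ≤ I₂ + N₀ / 2 := by linarith
    nlinarith
  have h8 : (1 - σ) * (1 + D * y) ≤ 1 - (N + M + 1) * y := by
    have e1 : (N + M + 1 + D) * σ * σ ≤ 1 * σ := by gcongr
    have e2 : 0 ≤ D * y * σ := by positivity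
    rw [hy] at *
    linarith
  have h9 : (1 + D * y) * ((1 - σ) * (P + 1 / 2 * J)) ≤ (1 + D * y) * E := by
    refine le_trans ?_ h7
    have : 0 ≤ P + 1 / 2 * J := by positivity
    calc _ = (1 - σ) * (1 + D * y) * (P + 1 / 2 * J) := by ring
      _ ≤ _ := by gcongr
  exact le_of_mul_le_mul_left h9 (by positivity)

/-- The Modica–Mortola inequality, with x = |∇u|² and y = W(u). -/
theorem mul_sqrt_mul_le (ε : ℝ) {x y : ℝ} (hx : 0 ≤ x) (hy : 0 ≤ y) :
    ε * (√(2 * y) * √x) ≤ ε ^ 2 / 2 * x + y := by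
  have h1 := Real.sq_sqrt hx
  have h2 := Real.sq_sqrt (by positivity : 0 ≤ 2 * y)
  nlinarith [sq_nonneg (ε * √x - √(2 * y))]

theorem ae_abs_comp_le {W : ℝ → ℝ} (hW : Continuous W) {u : Torus d → ℝ} {r : ℝ}
    (hu : ∀ᵐ x, |u x| ≤ r) : ∃ C, ∀ᵐ x, ‖W (u x)‖ ≤ C := by
  obtain ⟨C, hC⟩ := isCompact_Icc.exists_bound_of_continuousOn (s := Icc (-r) r) hW.continuousOn
  exact ⟨C, hu.mono fun x hx => hC _ (abs_le.1 hx)⟩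

theorem memLp_of_ae_abs_le {f : Torus d → ℝ} (hf : AEStronglyMeasurable f) {M : ℝ}
    (hM : ∀ᵐ x, |f x| ≤ M) (p : ENNReal) : MemLp f p := MemLp.of_bound hf M hM

/-- Comparison of the two nonlocal energies up to a correction `p` supported in a small set. -/
theorem nonlocal_comparison_of_support {G₀ G f p b : Torus d → ℝ} {κ A δ η : ℝ} (hA : 0 < A)
    (hκ : κ ^ 2 = A⁻¹) (hδ0 : 0 < δ) (hG₀ : IsCoulombKernel G₀) (hG : IsScreenedKernel κ G)
    (hf : MemLp f 2) (hp : MemLp p 2) (hb : MemLp b 2) {M : ℝ} (hfM : ∀ᵐ x, |f x| ≤ M)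
    (hpM : ∀ᵐ x, |p x| ≤ M) (hbM : ∀ᵐ x, |b x| ≤ M) (hf0 : ∫ x, f x = 0)
    {T : Set (Torus d)} (hTm : MeasurableSet T)
    (hpT : ∀ x, |p x| ≤ T.indicator (fun _ => (2 : ℝ)) x)
    (hv : ∀ᵐ x, |conv G₀ f x| ≤ η) {n : ℕ} (hn0 : 0 < n) :
    (1 - δ) * ∫ x, b x * conv G b x ≤
      A * (∫ x, (f x + p x - b x) ^ 2) + (∫ x, f x * conv G₀ f x)
        + (4 * η * volume.real T + ((2 * (n : ℝ) + 1) ^ d * (2 * volume.real T) ^ 2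
        + ((n : ℝ) ^ 2)⁻¹ * (4 * volume.real T) + A * δ⁻¹ * (2 * volume.real T) ^ 2)) := by
  set τ := (volume : Measure (Torus d)).real T with hτ
  have hcmp := nonlocal_comparison hA hκ hδ0 hG₀ hG hf hp hb hfM hpM hbM hf0
  have hself := hG₀.nonlocal_le hp hpM hn0
  have hind : ∫ x, T.indicator (fun _ => (2 : ℝ)) x = 2 * τ := by
    rw [integral_indicator hTm, setIntegral_const, smul_eq_mul, mul_comm]
  have hindi : Integrable (T.indicator fun _ : Torus d => (2 : ℝ)) :=
    (integrable_const _).indicator hTm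
  have hp1 : ∫ x, |p x| ≤ 2 * τ := by
    rw [← hind]
    exact integral_mono (hp.integrable one_le_two).abs hindi hpT
  have hpsq : ∫ x, p x ^ 2 ≤ 4 * τ := by
    have h1 : ∫ x, p x ^ 2 ≤ ∫ x, 2 * T.indicator (fun _ => (2 : ℝ)) x := by
      refine integral_mono hp.integrable_sq (hindi.const_mul 2) fun x => ?_
      have h2 := hpT x
      simp only
      rw [← sq_abs]
      by_cases hx : x ∈ T
      · rw [indicator_of_mem hx] at h2 ⊢
        nlinarith [abs_nonneg (p x)]
      · rw [indicator_of_notMem hx] at h2 ⊢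
        nlinarith [abs_nonneg (p x)]
    rw [integral_const_mul, hind] at h1
    linarith
  -- The assumed smallness of the Coulomb potential enters here.
  have hpv : ∫ x, p x * conv G₀ f x ≤ 2 * τ * η := by
    rw [← hind, ← integral_mul_const]
    have hi : Integrable fun x => p x * conv G₀ f x :=
      hp.integrable_mul (memLp_conv hG₀.1 (hf.integrable one_le_two) hfM 2)
    refine integral_mono_ae hi (hindi.mul_const η) ?_
    filter_upwards [hv] with x hx
    refine (le_abs_self _).trans ?_
    rw [abs_mul]
    have h0 := (abs_nonneg _).trans (hpT x)
    exact mul_le_mul (hpT x) hx (abs_nonneg _) h0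
  have hp10 : 0 ≤ ∫ x, |p x| := integral_nonneg fun x => abs_nonneg _
  have h1 : (2 * (n : ℝ) + 1) ^ d * (∫ x, |p x|) ^ 2 ≤ (2 * (n : ℝ) + 1) ^ d * (2 * τ) ^ 2 := by
    gcongr
  have h2 : ((n : ℝ) ^ 2)⁻¹ * ∫ x, p x ^ 2 ≤ ((n : ℝ) ^ 2)⁻¹ * (4 * τ) := by gcongr
  have h3 : A * δ⁻¹ * (∫ x, |p x|) ^ 2 ≤ A * δ⁻¹ * (2 * τ) ^ 2 := by gcongr
  linarith

/-! ### Assembly of the lower bound. -/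

-- Measurability of u makes its level sets measurable. The weak gradient is a parameter, so that
-- passing to another representative of u does not disturb the choice made in `weakGradient`.
set_option maxHeartbeats 400000 in
theorem exists_phase_energy_le_of_measurable {W : ℝ → ℝ} (hW : IsDoubleWell d W) :
    ∃ δ₀ : ℝ, 0 < δ₀ ∧ δ₀ ≤ 1 ∧ ∀ δ : ℝ, 0 < δ → δ ≤ δ₀ →
      ∀ G₀ : Torus d → ℝ, IsCoulombKernel G₀ →
      ∀ G : Torus d → ℝ, IsScreenedKernel (screening W) G →
      ∀ ε : ℝ, 0 < ε → ∀ (ubar : ℝ) (u : Torus d → ℝ) (g : Fin d → Torus d → ℝ),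
        Measurable u → MemLp u 2 → IsWeakGradient u g → ∫ x, u x = ubar →
        (∀ᵐ x, |u x| ≤ 1 + δ ^ 3) →
        (∀ᵐ x, |conv G₀ (fun y => u y - ubar) x| ≤ δ ^ 3) →
        (∫ x, (ε ^ 2 / 2 * ∑ i, g i x ^ 2 + W (u x)))
          + 1 / 2 * (∫ x, (u x - ubar) * conv G₀ (fun y => u y - ubar) x)
          ≤ δ ^ ((3 / 2 : ℝ) * ((d : ℝ) + 6)) →
        ∃ u₀ : Torus d → ℝ, IsBVSign u₀ ∧
          (1 - δ ^ (1 / 2 : ℝ)) * sharpEnergy ε G ubar u₀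
            ≤ (∫ x, (ε ^ 2 / 2 * ∑ i, g i x ^ 2 + W (u x)))
              + 1 / 2 * (∫ x, (u x - ubar) * conv G₀ (fun y => u y - ubar) x) := by
  obtain ⟨M, hM0, hM⟩ := hW.exists_quadratic_lower_bound
  obtain ⟨c, δ₁, hc0, hδ₁, hc⟩ := hW.exists_transition_lower_bound
  obtain ⟨N, hN0, hN⟩ := hW.exists_tension_lower_bound
  set A := deriv (deriv W) 1 with hAdef
  have hA : 0 < A := hW.second_deriv_pos
  have hκ : screening W ^ 2 = A⁻¹ := by
    rw [screening, div_pow, one_pow, Real.sq_sqrt hA.le, one_div]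
  have hκ0 : screening W ≠ 0 := by
    unfold screening
    have := Real.sqrt_pos.2 hA
    positivity
  -- The first three terms come from the frequency cut-off, the last 4 from the interaction term
  -- 4δ³τ.
  set C : ℝ := 4 * 5 ^ d / c + 4 + 4 * A / c + 4 with hCdef
  have hC0 : 0 < C := by positivity
  set S := N + M + 1 + C / (2 * c) with hS
  have hS0 : 0 < S := by positivity
  -- In order: the transition interval is nonempty, the transition bound applies, Mδ ≤ 1, and S√δ ≤
  -- 1.
  refine ⟨min (min (1 / 2) δ₁) (min (1 / M) ((1 / S) ^ 2)), by positivity,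
    (min_le_left _ _).trans ((min_le_left _ _).trans (by norm_num)), ?_⟩
  intro δ hδ0 hδ G₀ hG₀ G hG ε hε ubar u g hum hu hg hubar huδ hvδ hE
  have hδhalf : δ ≤ 1 / 2 := hδ.trans ((min_le_left _ _).trans (min_le_left _ _))
  have hδδ₁ : δ ≤ δ₁ := hδ.trans ((min_le_left _ _).trans (min_le_right _ _))
  have hδM : δ ≤ 1 / M := hδ.trans ((min_le_right _ _).trans (min_le_left _ _))
  have hδS : δ ≤ (1 / S) ^ 2 := hδ.trans ((min_le_right _ _).trans (min_le_right _ _))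
  have hδ1 : δ ≤ 1 := by linarith
  have hMδ : M * δ ≤ 1 := by rwa [le_div_iff₀ hM0, mul_comm] at hδM
  rw [← Real.sqrt_eq_rpow]
  set σ := √δ with hσdef
  have hσδ : σ ^ 2 = δ := Real.sq_sqrt hδ0.le
  have hσ0 : 0 < σ := Real.sqrt_pos.2 hδ0
  have hσ1 : σ ≤ 1 := Real.sqrt_le_one.2 hδ1
  have hσS : S * σ ≤ 1 := by
    have h1 : σ ≤ 1 / S := by rw [hσdef]; exact Real.sqrt_le_iff.2 ⟨by positivity, hδS⟩
    rwa [le_div_iff₀ hS0, mul_comm] at h1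
  have hδ3 : δ ^ 3 ≤ δ := by
    calc δ ^ 3 ≤ δ ^ 1 := pow_le_pow_of_le_one hδ0.le hδ1 (by norm_num)
      _ = δ := pow_one δ
  have hpow : δ ^ ((3 / 2 : ℝ) * ((d : ℝ) + 6)) = (σ ^ 3) ^ (d + 6) := by
    rw [← pow_mul, hσdef, Real.sqrt_eq_rpow, ← Real.rpow_natCast, ← Real.rpow_mul hδ0.le]
    congr 1
    push_cast
    ring
  have hWc : Continuous W := hW.contDiff.continuous
  have hu2 : ∀ᵐ x, |u x| ≤ 2 := huδ.mono fun x hx => by linarith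
  set w : ℝ → ℝ := fun t => √(2 * W t) with hw
  have hwc : Continuous w := by fun_prop
  have hw0 : ∀ t, 0 ≤ w t := fun t => Real.sqrt_nonneg _
  have hgN : Integrable (gradNorm g) := (memLp_gradNorm fun i => (hg i).1).integrable one_le_two
  have hwg : Integrable fun x => w (u x) * gradNorm g x := by
    obtain ⟨C, hC⟩ := ae_abs_comp_le hwc hu2
    exact hgN.bdd_mul (hwc.measurable.comp hum).aestronglyMeasurable hC
  set a := -1 + δ with ha
  set b := 1 - δ with hb
  have hab : a < b := by linarith
  have hwab : ∀ t ∈ Ioo a b, 0 < w t := by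
    intro t ht
    refine Real.sqrt_pos.2 (mul_pos two_pos (lt_of_lt_of_le (by positivity : 0 < c * δ ^ 2)
      (hc δ hδ0 hδδ₁ t (abs_le.2 ⟨by linarith [ht.1], ht.2.le⟩))))
  obtain ⟨s, hs, hTV, hcoarea⟩ :=
    hg.exists_totalVariation_phaseAbove_le hum hu hwc hw0 hwg hab hwab
  set T := u ⁻¹' Ioc a b with hT
  have hTm : MeasurableSet T := hum measurableSet_Ioc
  set u₀ := phaseAbove u s with hu₀
  have hu₀m : Measurable u₀ := measurable_phaseAbove hum s
  have hu₀1 : ∀ x, |u₀ x| = 1 := fun x => by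
    rcases phaseAbove_eq_or u s x with h | h <;> simp [hu₀, h]
  have hu₀int : Integrable u₀ :=
    (memLp_of_ae_abs_le hu₀m.aestronglyMeasurable (ae_of_all _ fun x => (hu₀1 x).le) 1).integrable le_rfl
  refine ⟨u₀, ⟨hu₀int, hTV, phaseAbove_eq_or u s⟩, ?_⟩
  set P := ε / 2 * (totalVariation u₀).toReal with hP
  set e := fun x => ε ^ 2 / 2 * ∑ i, g i x ^ 2 + W (u x) with he
  have he0 : ∀ x, 0 ≤ e x := fun x => add_nonneg
    (mul_nonneg (by positivity) (Finset.sum_nonneg fun _ _ => sq_nonneg _)) (hW.nonneg _)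
  have hei : Integrable e := by
    obtain ⟨C, hC⟩ := ae_abs_comp_le hWc hu2
    have h1 : Integrable fun x => W (u x) :=
      (memLp_of_ae_abs_le (hWc.measurable.comp hum).aestronglyMeasurable hC 1).integrable le_rfl
    exact ((integrable_finsetSum _ fun i _ => (hg i).1.integrable_sq).const_mul _).add h1
  set τ := (volume : Measure (Torus d)).real T with hτ
  set f := fun x => u x - ubar with hf
  set p := T.indicator fun x => u₀ x - u x with hp
  set β := fun x => u₀ x - ubar with hβ
  have hsplit : ∫ x, e x = (∫ x in T, e x) + ∫ x in Tᶜ, e x := (integral_add_compl hTm hei).symm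
  -- interface part
  have hI1 : (1 - N * σ ^ 2) * P ≤ ∫ x in T, e x := by
    have h1 : ε * ∫ x in T, w (u x) * gradNorm g x ≤ ∫ x in T, e x := by
      rw [← integral_const_mul]
      refine integral_mono (hwg.const_mul ε).integrableOn hei.integrableOn fun x => ?_
      exact mul_sqrt_mul_le ε (Finset.sum_nonneg fun _ _ => sq_nonneg _) (hW.nonneg _)
    refine le_trans ?_ h1
    have h2 := hN δ hδ0.le hδ1
    have h3 : (1 - N * δ) * (totalVariation u₀).toReal ≤ 2 * ∫ x in T, w (u x) * gradNorm g x :=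
      (mul_le_mul_of_nonneg_right h2 ENNReal.toReal_nonneg).trans hcoarea
    rw [hσδ, hP]
    have h4 := mul_le_mul_of_nonneg_left h3 (by positivity : 0 ≤ ε / 2)
    linarith
  -- transition measure
  have hτe : c * (σ ^ 2) ^ 2 * τ ≤ ∫ x in T, e x := by
    rw [hσδ]
    have : c * δ ^ 2 * τ = ∫ x in T, c * δ ^ 2 := by
      rw [setIntegral_const, smul_eq_mul, mul_comm]
    rw [this]
    refine setIntegral_mono_on (integrable_const _).integrableOn hei.integrableOn hTm fun x hx => ?_
    have h1 := hc δ hδ0 hδδ₁ (u x) (abs_le.2 ⟨by linarith [hx.1], hx.2⟩)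
    have h2 : 0 ≤ ε ^ 2 / 2 * ∑ i, g i x ^ 2 :=
      mul_nonneg (by positivity) (Finset.sum_nonneg fun _ _ => sq_nonneg _)
    simp only [he]
    linarith
  -- bulk part
  have hpT : ∀ x, |p x| ≤ T.indicator (fun _ => (2 : ℝ)) x := by
    intro x
    by_cases hx : x ∈ T
    · simp only [hp, indicator_of_mem hx]
      have h1 := abs_le.1 (hu₀1 x).le
      have h2 := hx.1
      have h3 := hx.2
      rw [abs_le]
      constructor <;> linarith
    · simp [hp, indicator_of_notMem hx]
  have hfpb : ∀ x, (f x + p x - β x) ^ 2 = Tᶜ.indicator (fun x => (u x - u₀ x) ^ 2) x := by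
    intro x
    by_cases hx : x ∈ T
    · rw [indicator_of_notMem (by simpa using hx)]
      simp only [hp, indicator_of_mem hx, hf, hβ]
      ring
    · rw [indicator_of_mem (by simpa using hx)]
      simp only [hp, indicator_of_notMem hx, hf, hβ]
      ring
  have hf2 : MemLp f 2 := hu.sub (memLp_const ubar)
  have hu₀2 : MemLp u₀ 2 :=
    memLp_of_ae_abs_le hu₀m.aestronglyMeasurable (ae_of_all _ fun x => (hu₀1 x).le) 2
  have hβ2 : MemLp β 2 := hu₀2.sub (memLp_const ubar)
  have hp2 : MemLp p 2 := (hu₀2.sub hu).indicator hTm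
  have hfM : ∀ᵐ x, |f x| ≤ 2 + |ubar| := hu2.mono fun x hx =>
    (abs_sub _ _).trans (by linarith)
  have hpM : ∀ᵐ x, |p x| ≤ 2 + |ubar| := ae_of_all _ fun x => (hpT x).trans <| by
    by_cases hx : x ∈ T
    · rw [indicator_of_mem hx]; linarith [abs_nonneg ubar]
    · rw [indicator_of_notMem hx]; positivity
  have hβM : ∀ᵐ x, |β x| ≤ 2 + |ubar| := ae_of_all _ fun x =>
    (abs_sub _ _).trans (by linarith [hu₀1 x])
  have hI2 : (1 - M * σ ^ 2) * (A / 2 * ∫ x, (f x + p x - β x) ^ 2) ≤ ∫ x in Tᶜ, e x := by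
    rw [hσδ, ← integral_indicator hTm.compl, ← integral_const_mul, ← integral_const_mul]
    refine integral_mono_ae ?_ (hei.indicator hTm.compl) ?_
    · exact ((((hf2.add hp2).sub hβ2).integrable_sq).const_mul _).const_mul _
    · filter_upwards [huδ] with x hx
      rw [hfpb]
      by_cases hxT : x ∈ Tᶜ
      · rw [indicator_of_mem hxT, indicator_of_mem hxT]
        have hx' := abs_le.1 hx
        have h2 : 0 ≤ ε ^ 2 / 2 * ∑ i, g i x ^ 2 :=
          mul_nonneg (by positivity) (Finset.sum_nonneg fun _ _ => sq_nonneg _)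
        have hor : u x ≤ a ∨ b < u x := by
          by_contra! hcon
          exact hxT ⟨hcon.1, hcon.2⟩
        suffices H : (1 - M * δ) * (A / 2 * (u x - u₀ x) ^ 2) ≤ W (u x) by
          simp only [he]
          linarith
        -- As s lies in (a, b), u₀ is the well on the side of u; δ³ ≤ δ keeps overshoots beyond ±1
        -- within the range of the quadratic bound.
        rcases hor with h | h
        · have hv : u₀ x = -1 := if_neg (not_lt.2 (h.trans hs.1.le))
          have h3 := hM δ hδ0.le hδ1 (-u x) (abs_le.2 ⟨by linarith, by linarith⟩)
          rw [hW.even] at h3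
          rw [hv]
          convert h3 using 3
          ring
        · have hv : u₀ x = 1 := if_pos (hs.2.trans h)
          rw [hv]
          exact hM δ hδ0.le hδ1 (u x) (abs_le.2 ⟨by linarith, by linarith⟩)
      · rw [indicator_of_notMem hxT, indicator_of_notMem hxT]
        simp
  -- nonlocal part
  have hf0 : ∫ x, f x = 0 := by
    rw [hf, integral_sub (hu.integrable one_le_two) (integrable_const _), hubar]
    simp
  set J := ∫ x, β x * conv G β x with hJ
  set N₀ := ∫ x, f x * conv G₀ f x with hN₀
  have hJ0 : 0 ≤ J := nonlocal_nonneg hG.1 (hG.coeff_eq hκ0)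
    (fun k => inv_nonneg.2 (add_nonneg (freq_nonneg k) (sq_nonneg _))) hβ2 hβM
  have hN₀0 : 0 ≤ N₀ := nonlocal_nonneg hG₀.1 hG₀.coeff_eq
    (fun k => inv_nonneg.2 (freq_nonneg k)) hf2 hfM
  have hτ0 : 0 ≤ τ := measureReal_nonneg
  have hcompl0 : 0 ≤ ∫ x in Tᶜ, e x := integral_nonneg fun x => he0 x
  -- The Coulomb energy and the local energy off T are nonnegative, so the total energy alone
  -- controls the measure of T.
  have hτE : c * σ ^ 4 * τ ≤ (σ ^ 3) ^ (d + 6) := by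
    rw [← hpow]
    refine le_trans ?_ hE
    have : c * σ ^ 4 * τ = c * (σ ^ 2) ^ 2 * τ := by ring
    rw [this]
    linarith [hsplit]
  obtain ⟨n, hn0, hn⟩ := exists_cutoff_error_le d hσ0 hσ1 hc0 hA hτ0 hτE
  have hcmp := nonlocal_comparison_of_support hA hκ hδ0 hG₀ hG hf2 hp2 hβ2 hfM hpM hβM hf0 hTm hpT
    hvδ hn0
  rw [← hσδ] at hcmp
  rw [sharpEnergy, nonlocalEnergy_eq]
  refine energy_bookkeeping (Q := ∫ x, (f x + p x - β x) ^ 2) hσ0 hM0 hN0 hc0 hC0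
    (by rwa [hσδ]) hσS (by positivity) hJ0 hN₀0 hτ0 ?_ hI1 hI2 hcmp ?_ ?_
  · rw [hsplit]; ring
  · rw [hCdef, ← hτ]
    have : 4 * (σ ^ 2) ^ 3 * τ = 4 * (σ ^ 6 * τ) := by ring
    linarith
  · linarith [hsplit]

end Torus

end

/-! ### Passage to a measurable representative. -/

theorem propositionp (d : ℕ) (hd : 1 ≤ d) (W : ℝ → ℝ) (hW : Torus.IsDoubleWell d W) :
    ∃ δ₀ : ℝ, 0 < δ₀ ∧ ∀ δ : ℝ, 0 < δ → δ ≤ δ₀ →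
      ∀ G₀ : Torus d → ℝ, Torus.IsCoulombKernel G₀ →
      ∀ G : Torus d → ℝ, Torus.IsScreenedKernel (Torus.screening W) G →
      ∀ ε : ℝ, 0 < ε → ∀ (ubar : ℝ) (u : Torus d → ℝ), Torus.MemH1 u →
        ∫ x, u x = ubar →
        (∀ᵐ x, |u x| ≤ 1 + δ ^ 3) →
        (∀ᵐ x, |Torus.potential G₀ ubar u x| ≤ δ ^ 3) →
        Torus.diffuseEnergy ε W G₀ ubar u ≤ δ ^ ((3 / 2 : ℝ) * ((d : ℝ) + 6)) →
        ∃ u₀ : Torus d → ℝ, Torus.IsBVSign u₀ ∧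
          (1 - δ ^ (1 / 2 : ℝ)) * Torus.sharpEnergy ε G ubar u₀
            ≤ Torus.diffuseEnergy ε W G₀ ubar u := by
  obtain ⟨δ₀, hδ₀, -, H⟩ := Torus.exists_phase_energy_le_of_measurable hW
  refine ⟨δ₀, hδ₀, fun δ hδ hδδ₀ G₀ hG₀ G hG ε hε ubar u hu hubar hu1 hv hE => ?_⟩
  obtain ⟨hu2, hex⟩ := hu
  have hwg : Torus.IsWeakGradient u (Torus.weakGradient u) := by
    rw [Torus.weakGradient, dif_pos hex]
    exact hex.choose_spec
  set u' : Torus d → ℝ := hu2.1.mk u with hu'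
  have huu' : u =ᵐ[volume] u' := hu2.1.ae_eq_mk
  have hconv : ∀ x, Torus.conv G₀ (fun y => u' y - ubar) x = Torus.potential G₀ ubar u x := by
    intro x
    refine integral_congr_ae ?_
    filter_upwards [huu'] with y hy
    rw [hy]
  have henergy : (∫ x, (ε ^ 2 / 2 * ∑ i, Torus.weakGradient u i x ^ 2 + W (u' x)))
      + 1 / 2 * (∫ x, (u' x - ubar) * Torus.conv G₀ (fun y => u' y - ubar) x)
      = Torus.diffuseEnergy ε W G₀ ubar u := by
    rw [Torus.diffuseEnergy, Torus.nonlocalEnergy_eq]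
    congr 1
    · refine integral_congr_ae ?_
      filter_upwards [huu'] with x hx
      rw [hx]
    · congr 1
      refine integral_congr_ae ?_
      filter_upwards [huu'] with x hx
      rw [hx, hconv]
      rfl
  have hwg' : Torus.IsWeakGradient u' (Torus.weakGradient u) := fun i => ⟨(hwg i).1, fun φ hφ => by
    rw [← (hwg i).2 φ hφ]
    refine integral_congr_ae ?_
    filter_upwards [huu'] with x hx
    rw [hx]⟩
  have h := H δ hδ hδδ₀ G₀ hG₀ G hG ε hε ubar u' (Torus.weakGradient u)
    hu2.1.stronglyMeasurable_mk.measurable (hu2.ae_eq huu') hwg'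
    (by rw [← hubar]; exact (integral_congr_ae huu').symm)
    (by filter_upwards [hu1, huu'] with x h1 h2 using h2 ▸ h1)
    (by filter_upwards [hv] with x h1 using (hconv x).symm ▸ h1)
  rw [henergy] at h
  exact h hE
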